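/- **Model.** A stream of a graph on the vertex set $\{1,\dots,n\}$ is a finite sequence of tokens $(u,v,\Delta)$ with $u\neq v$ and $\Delta\in\mathbb Z$; the token adds $\Delta$ to the multiplicity of the edge $\{u,v\}$. If all final multiplicities are nonnegative, the stream $\sigma$ describes the multigraph $G_\sigma$ with these multiplicities, and $\alpha'(G_\sigma)$ denotes the size of a maximum matching in it. MaxMatching is the function $\sigma\mapsto\alpha'(G_\sigma)$. A verifier draws coins $R$ uniformly from a finite set, has a memory of $v$ bits (at most $2^v$ configurations), and updates its memory, depending on $R$, after each token of $\sigma$; it then reads a proof string bit by bit, updating its memory after each bit; finally it outputs a natural number or rejects ($\bot$). Write $\mathrm{out}_R(\sigma,H)$ for the output on the stream $\sigma$ and the proof string $H$. It is an $(h,v)$-scheme for MaxMatching on a class of streams, with completeness error $\varepsilon_c$ and soundness error $\varepsilon_s$, if for every stream $\sigma$ of the class * there is a string $H$ of at most $h$ bits with $\Pr_R[\mathrm{out}_R(\sigma,H)=\alpha'(G_\sigma)]\ge 1-\varepsilon_c$, and * for every string $H'$, $\Pr_R[\mathrm{out}_R(\sigma,H')\notin\{\alpha'(G_\sigma),\bot\}]\le\varepsilon_s$.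 Here $h$ and $v$ are exact bit counts. **Theorem.** 1. There is an $[nt,s]$-scheme for MaxMatching, where $[\cdot,\cdot]$ suppresses factors polynomial in $\log n$. Precisely: for every $d\in\mathbb N$ there are constants $C,k$ such that for all integers $n,t,s\ge 1$ with $ts\ge n$ (in particular whenever $ts=n$) there are $h\le C\,nt\,\log^k(n+1)$ and $v\le C\,s\,\log^k(n+1)$ and an $(h,v)$-scheme for MaxMatching on all streams with final multiplicities in $\{0,1,\dots,n^d\}$, with completeness error $0$ and soundness error at most $1/3$. The coins can be drawn from a set of size at most $2^v$. 2. This is optimal up to logarithmic factors: there is an absolute constant $c>0$ such that for all $n\ge 2$, $h\ge 1$ and $v\ge 0$, every $(h,v)$-scheme for MaxMatching with completeness error and soundness error at most $1/3$ satisfies $hv\ge c\,n^2$. This holds even if the scheme is only required to work for streams that insert the edges of a simple graph, each edge once, without deletions. -/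

import Mathlib

namespace GraphStream

/-- A token `(u, v, Δ)` of a graph stream on the vertex set `{0, …, n-1}`: the integer `Δ`
(possibly negative) is added to the multiplicity of the edge `{u, v}`, where `u ≠ v`. -/
structure EdgeUpdate (n : ℕ) where
  u : Fin n
  v : Fin n
  ne : u ≠ v
  Δ : ℤ

/-- The final multiplicity of the edge `e` after all updates of the stream. -/
def edgeMult {n : ℕ} (σ : List (EdgeUpdate n)) (e : Sym2 (Fin n)) : ℤ :=
  (σ.map fun a => if s(a.u, a.v) = e then a.Δ else 0).sum

/-- The (underlying simple graph of the) multigraph described by a stream: the edges are the pairs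
whose final multiplicity is positive. -/
def graphOf {n : ℕ} (σ : List (EdgeUpdate n)) : SimpleGraph (Fin n) :=
  SimpleGraph.fromEdgeSet {e | 0 < edgeMult σ e}

/-- Turnstile streams (arbitrary insertions and deletions) describing a multigraph whose edge
multiplicities are at most `B`. For `B = 1` these are the turnstile streams of simple graphs. -/
def IsTurnstileStream {n : ℕ} (B : ℕ) (σ : List (EdgeUpdate n)) : Prop :=
  ∀ e, 0 ≤ edgeMult σ e ∧ edgeMult σ e ≤ B

/-- Insertion-only streams of simple graphs: every token inserts one edge, and no edge is inserted
twice. -/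
def IsInsertionStream {n : ℕ} (σ : List (EdgeUpdate n)) : Prop :=
  (∀ a ∈ σ, a.Δ = 1) ∧ ∀ e, edgeMult σ e ≤ 1

/-- The maximum number of edges in a matching of `G`. -/
noncomputable def matchingNumber {V : Type*} [Finite V] (G : SimpleGraph V) : ℕ :=
  sSup {k | ∃ M : G.Subgraph, M.IsMatching ∧ M.edgeSet.ncard = k}

/-- A randomized streaming verifier for `n`-vertex graph streams. It draws `R` uniformly from the
finite set `Coins`, reads the input stream token by token and then the proof stream bit by bit,
each time updating its memory, and finally outputs a number or rejects (`none`). -/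
structure Verifier (n : ℕ) where
  Coins : Type
  Mem : Type
  coins_finite : Finite Coins
  coins_nonempty : Nonempty Coins
  mem_finite : Finite Mem
  /-- initial memory contents -/
  start : Coins → Mem
  /-- processing of one token of the input stream -/
  readToken : Coins → Mem → EdgeUpdate n → Mem
  /-- processing of one bit of the proof stream -/
  readHelp : Coins → Mem → Bool → Mem
  /-- the final answer, `none` meaning "reject" -/
  answer : Coins → Mem → Option ℕ

namespace Verifier

variable {n : ℕ} (S : Verifier n)

/-- The summary of the input stream: the memory contents when the input stream ends. -/
def summary (R : S.Coins) (σ : List (EdgeUpdate n)) : S.Mem :=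
  σ.foldl (S.readToken R) (S.start R)

/-- The output on summary `m` and proof stream `help`. -/
def out (R : S.Coins) (m : S.Mem) (help : List Bool) : Option ℕ :=
  S.answer R (help.foldl (S.readHelp R) m)

/-- Probability of an event over the uniformly random coins. -/
noncomputable def prob (p : S.Coins → Prop) : ℝ :=
  (Nat.card {R : S.Coins // p R} : ℝ) / (Nat.card S.Coins : ℝ)

/-- The verifier uses at most `v` bits of memory. -/
def SpaceAtMost (v : ℕ) : Prop := Nat.card S.Mem ≤ 2 ^ v

/-- The verifier uses at most `v` random bits. -/
def CoinsAtMost (v : ℕ) : Prop := Nat.card S.Coins ≤ 2 ^ v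

/-- `S` is (the verifier of) a scheme for the function `f` on the streams satisfying `valid`, with
at most `h` bits of help, at most `v` bits of verifier memory, completeness error at most `εc`, and
soundness error at most `εs`. -/
structure IsScheme (valid : List (EdgeUpdate n) → Prop) (f : List (EdgeUpdate n) → ℕ)
    (εc εs : ℝ) (h v : ℕ) : Prop where
  space : S.SpaceAtMost v
  complete : ∀ σ, valid σ → ∃ help : List Bool, help.length ≤ h ∧
    1 - εc ≤ S.prob fun R => S.out R (S.summary R σ) help = some (f σ)
  sound : ∀ σ, valid σ → ∀ help : List Bool,
    S.prob (fun R => S.out R (S.summary R σ) help ∉ ({some (f σ), none} : Set (Option ℕ))) ≤ εs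

end Verifier

/-- The maximum matching problem: the stream `σ` is mapped to the size of a maximum matching of the
graph it describes. -/
noncomputable def maxMatching {n : ℕ} (σ : List (EdgeUpdate n)) : ℕ :=
  matchingNumber (graphOf σ)

end GraphStream

/-!
Both parts rest on certificates for maximum matchings. A matching is encoded as an involution of the
vertex set, and a certificate (`SimpleGraph.IsMatchingCert`) is a vertex labelling that combines the
barrier and the odd components of the Tutte-Berge formula. Its conditions only concern single pairs
of vertices, and by Gallai's lemma every maximum matching has a certificate
(`IsMatchingCert.isMaxMatchingMap`, `IsMaxMatchingMap.exists_cert`).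

*The scheme.* The prover repeats the list of all vertices, with their partners, the multiplicities of
the matching edges and the labels, `2 t` times. The vertices are covered by `t` chunks of size `s`.
During two rounds through the list the verifier first stores the data of one chunk and then examines
all pairs of a vertex and a member of the chunk. The graph itself is only available as a linear
sketch: for each `b < s`, the multiplicities of the pairs treated at the positions of the list and the
`b`-th members of the chunks are interpolated by a polynomial over a prime field, and evaluated at
a random point `r`. The same is done with the indicator of the pairs whose multiplicity the
certificate prescribes and with the prescribed values. A sum of squares of the deviations, plus the
number of violations of the certificate, is a polynomial of degree less than `3 len` in the position,
where `len = 2 n t`; as an integer it is smaller than the field, so everything is in order if and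
only if it vanishes at all positions, that is, if it is a multiple of the polynomial `nodal` with
these zeros. The prover sends the quotient, and the identity is checked at `r`. That all repetitions
of the list are the same is another polynomial identity checked at `r`. A false identity holds for
at most `3 len` points (`SchemeParams.card_wrong_le`, `SchemeParams.exists_help`).

*The lower bound.* The bits of an instance of the index problem are the edges of a bipartite graph;
pendant edges at all vertices but `i` on one side and `j` on the other make the matching number
depend on the bit at `(i, j)` alone (`isMaxMatchingMap_gadget`). Repeating the summary of the stream `O(h)` times makes the error
smaller than the inverse of the number of proof strings, so that they can all be tried, and the index
problem is solved by a message of `O(h v)` bits (`Verifier.IsScheme.card_le_of_index`). Such a message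
must have linear length (`index_lower_bound`).
-/

/-! ### Matchings as involutions and Gallai's lemma -/

namespace SimpleGraph

variable {V : Type*} {G : SimpleGraph V} {f g : V → V}

/-- A matching of `G`, encoded as an involution `f` of the vertex set: matched vertices are swapped
with their partner, and the fixed points are the unmatched vertices. -/
structure IsMatchingMap (G : SimpleGraph V) (f : V → V) : Prop where
  invol : ∀ u, f (f u) = u
  adj : ∀ u, f u ≠ u → G.Adj u (f u)

variable [Fintype V] [DecidableEq V]

/-- The unmatched vertices of the matching encoded by `f`. -/
def exposed (f : V → V) : Finset V := Finset.univ.filter fun u => f u = u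

@[simp] lemma mem_exposed {u : V} : u ∈ exposed f ↔ f u = u := by simp [exposed]

/-- A maximum matching: one with the fewest unmatched vertices. -/
structure IsMaxMatchingMap (G : SimpleGraph V) (f : V → V) : Prop extends IsMatchingMap G f where
  card_le : ∀ g, IsMatchingMap G g → (exposed f).card ≤ (exposed g).card

lemma exists_isMaxMatchingMap (G : SimpleGraph V) : ∃ f, IsMaxMatchingMap G f := by
  have : Nonempty {f : V → V // IsMatchingMap G f} := ⟨⟨id, ⟨fun _ => rfl, fun u h => absurd rfl h⟩⟩⟩
  obtain ⟨f, hf⟩ := Finite.exists_min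
    (fun f : {f : V → V // IsMatchingMap G f} => (exposed f.1).card)
  exact ⟨f.1, f.2, fun g hg => hf ⟨g, hg⟩⟩

/-- Otherwise the edge between the two unmatched vertices could be added to the matching. -/
lemma IsMaxMatchingMap.not_exposed_of_adj (hg : IsMaxMatchingMap G g) {x y : V} (hxy : G.Adj x y)
    (hx : g x = x) : g y ≠ y := by
  intro hy
  have hne := hxy.ne
  set g' : V → V := fun a => if a = x then y else if a = y then x else g a with hg'
  have hm : IsMatchingMap G g' := by
    refine ⟨fun a => ?_, fun a ha => ?_⟩
    · have h := hg.invol a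
      have h1 := hg.invol x
      simp only [hg']
      grind
    · have h := hg.adj a
      have := hxy.symm
      simp only [hg'] at ha ⊢
      grind
  have hsub : exposed g' ⊆ (exposed g).erase x := by
    intro a
    simp only [mem_exposed, Finset.mem_erase, hg']
    grind
  have h1 := hg.card_le g' hm
  have h2 := Finset.card_le_card hsub
  have h3 := Finset.card_erase_lt_of_mem (mem_exposed.2 hx)
  omega

/-- Gallai's lemma: if every vertex is missed by some maximum matching, then a maximum matching
misses at most one vertex of each connected component. -/
lemma IsMaxMatchingMap.not_exposed_of_reachable
    (hG : ∀ w, ∃ g, IsMaxMatchingMap G g ∧ g w = w) {u v : V} (p : G.Walk u v) :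
    ∀ f, IsMaxMatchingMap G f → u ≠ v → f u = u → f v ≠ v := by
  induction p with
  | nil => intro f _ h; exact absurd rfl h
  | @cons u w v huw p ih =>
    intro f hf huv hu hv
    by_cases hwv : w = v
    · subst hwv; exact hf.not_exposed_of_adj huw hu hv
    -- among the maximum matchings missing `w`, one that agrees with `f` as much as possible
    have : Nonempty {g : V → V // IsMaxMatchingMap G g ∧ g w = w} :=
      let ⟨g, hg⟩ := hG w; ⟨⟨g, hg⟩⟩
    obtain ⟨⟨g, hg, hgw⟩, hmax⟩ := Finite.exists_max
      (fun g : {g : V → V // IsMaxMatchingMap G g ∧ g w = w} =>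
        (Finset.univ.filter fun a => f a = g.1 a).card)
    have hgv : g v ≠ v := ih g hg hwv hgw
    have hgu : g u ≠ u := hg.not_exposed_of_adj huw.symm hgw
    have hfw : f w ≠ w := hf.not_exposed_of_adj huw hu
    have hcard : (exposed f).card = (exposed g).card :=
      le_antisymm (hf.card_le g hg.toIsMatchingMap) (hg.card_le f hf.toIsMatchingMap)
    have h2 : 1 < (exposed g \ exposed f).card := by
      have := Finset.card_sdiff_add_card_inter (exposed f) (exposed g)
      have := Finset.card_sdiff_add_card_inter (exposed g) (exposed f)
      rw [Finset.inter_comm] at this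
      have h3 : 1 < (exposed f \ exposed g).card :=
        Finset.one_lt_card.2 ⟨u, by simp [hu, hgu], v, by simp [hv, hgv], huv⟩
      omega
    obtain ⟨x, hx, hxw⟩ := Finset.exists_mem_ne h2 w
    simp only [Finset.mem_sdiff, mem_exposed] at hx
    obtain ⟨hgx, hfx⟩ := hx
    have hadj := hf.adj x hfx
    have hgy : g (f x) ≠ f x := hg.not_exposed_of_adj hadj hgx
    have hffx := hf.invol x
    set y := f x with hy
    set z := g y with hz
    have hgz : g z = y := hg.invol y
    have hzx : z ≠ x := by intro h; rw [h, hgx] at hgz; exact hfx hgz.symm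
    -- exchanging the edge `yz` of `g` for the edge `xy` of `f` increases the agreement
    set g' : V → V := fun a => if a = x then y else if a = y then x else if a = z then z else g a
      with hg'
    have hm : IsMatchingMap G g' := by
      refine ⟨fun a => ?_, fun a ha => ?_⟩
      · have h := hg.invol a
        simp only [hg']
        grind
      · have h := hg.adj a
        have := hadj.symm
        simp only [hg'] at ha ⊢
        grind
    have hsub : exposed g' ⊆ insert z ((exposed g).erase x) := by
      intro a
      simp only [mem_exposed, Finset.mem_erase, hg', Finset.mem_insert]
      grind
    have hle : (exposed g').card ≤ (exposed g).card := by
      have h1 := Finset.card_le_card hsub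
      have h2 := Finset.card_insert_le z ((exposed g).erase x)
      have h3 := Finset.card_erase_add_one (mem_exposed.2 hgx)
      omega
    have hmax' : IsMaxMatchingMap G g' := ⟨hm, fun k hk => hle.trans (hg.card_le k hk)⟩
    have hwy : w ≠ y := by rintro rfl; exact hgy hgw
    have hg'w : g' w = w := by
      simp only [hg']
      grind
    have hlt : (Finset.univ.filter fun a => f a = g a).card
        < (Finset.univ.filter fun a => f a = g' a).card := by
      apply Finset.card_lt_card
      rw [Finset.ssubset_iff_of_subset]
      · exact ⟨x, by simp [hg', hy], by simp [hgx, ← hy, hfx]⟩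
      · intro a
        simp only [Finset.mem_filter, Finset.mem_univ, true_and, hg']
        intro ha
        have h4 := hf.invol a
        grind
    exact absurd (hmax ⟨g', hmax', hg'w⟩) (not_le.2 hlt)

/-! ### Certificates of maximality -/

/-- A certificate that the matching `f` is maximum. The vertices labelled `none` form a
Tutte-Berge barrier `U`, and the other vertices are divided into classes by their label, with no
edge between different classes. The conditions `unmatched` and `barrier` force a vertex that is
unmatched, or matched into `U`, to be the vertex its class is labelled with; so every class has at
most one such vertex. -/
structure IsMatchingCert (G : SimpleGraph V) (f : V → V) (l : V → Option V) : Prop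
    extends IsMatchingMap G f where
  unmatched : ∀ u, f u = u → l u = some u
  barrier : ∀ u, f u ≠ u → l u = none → l (f u) = some (f u)
  noCross : ∀ u w z z', G.Adj u w → l u = some z → l w = some z' → z = z'

/-- Weak duality. In a class whose label is unmatched or matched into `U`, the matching `f` pairs
off the other vertices, so the class is odd and every matching `g` leaves one of its vertices
unmatched or matches it into `U`; there are `|exposed f| + |U|` such classes. -/
lemma IsMatchingCert.isMaxMatchingMap {l : V → Option V} (h : IsMatchingCert G f l) :
    IsMaxMatchingMap G f := by
  refine ⟨h.toIsMatchingMap, fun g hg => ?_⟩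
  set U : Finset V := Finset.univ.filter fun u => l u = none with hU
  have hfinj : Function.Injective f := Function.LeftInverse.injective h.invol
  have hginj : Function.Injective g := Function.LeftInverse.injective hg.invol
  have hUf : ∀ u ∈ U, f u ≠ u := by
    intro u hu hfu
    have := h.unmatched u hfu
    simp_all
  set R := exposed f ∪ U.image f with hR
  have hRcard : R.card = (exposed f).card + U.card := by
    rw [hR, Finset.card_union_of_disjoint, Finset.card_image_of_injective _ hfinj]
    rw [Finset.disjoint_left]
    intro a ha hb
    obtain ⟨u, hu, rfl⟩ := Finset.mem_image.1 hb
    rw [mem_exposed, h.invol] at ha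
    exact hUf u hu ha.symm
  have hRl : ∀ z ∈ R, l z = some z := by
    intro z hz
    rcases Finset.mem_union.1 hz with hz | hz
    · exact h.unmatched z (mem_exposed.1 hz)
    · obtain ⟨u, hu, rfl⟩ := Finset.mem_image.1 hz
      exact h.barrier u (hUf u hu) (by simpa [hU] using hu)
  have hRf : ∀ z ∈ R, f z = z ∨ l (f z) = none := by
    intro z hz
    rcases Finset.mem_union.1 hz with hz | hz
    · exact Or.inl (mem_exposed.1 hz)
    · obtain ⟨u, hu, rfl⟩ := Finset.mem_image.1 hz
      rw [h.invol]
      exact Or.inr (by simpa [hU] using hu)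
  -- the class of a root has a vertex that `g` does not pair inside the class
  have key : ∀ z ∈ R, ∃ y, l y = some z ∧ (g y = y ∨ l (g y) = none) := by
    intro z hz
    by_contra! hcon
    set C : Finset V := Finset.univ.filter fun u => l u = some z with hC
    have h0 : (∑ _u ∈ C, (1 : ZMod 2)) = 0 := by
      refine Finset.sum_involution (fun u _ => g u) ?_ ?_ ?_ ?_
      · intro u _; decide
      · intro u hu _
        exact (hcon u (by simpa [hC] using hu)).1
      · intro u hu
        have hu' : l u = some z := by simpa [hC] using hu
        obtain ⟨h1, h2⟩ := hcon u hu'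
        obtain ⟨z', hz'⟩ := Option.ne_none_iff_exists'.1 h2
        have := h.noCross u (g u) z z' (hg.adj u h1) hu' hz'
        simp [hC, hz', this]
      · intro u _; exact hg.invol u
    have h1 : (∑ _u ∈ C.erase z, (1 : ZMod 2)) = 0 := by
      refine Finset.sum_involution (fun u _ => f u) ?_ ?_ ?_ ?_
      · intro u _; decide
      · intro u hu _ hfu
        have := h.unmatched u hfu
        simp_all
      · intro u hu
        have hu' : u ≠ z ∧ l u = some z := by simpa [hC] using hu
        obtain ⟨huz, hlu⟩ := hu'
        have hfu : f u ≠ u := by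
          intro hfu
          have := h.unmatched u hfu
          simp_all
        have hadj := h.adj u hfu
        have hln : l (f u) ≠ none := by
          intro hn
          have := h.barrier (f u) (by rw [h.invol]; exact hfu.symm) hn
          rw [h.invol, hlu] at this
          exact huz (Option.some.inj this).symm
        obtain ⟨z', hz'⟩ := Option.ne_none_iff_exists'.1 hln
        have hzz := h.noCross u (f u) z z' hadj hlu hz'
        have hfz : f u ≠ z := by
          rintro rfl
          rcases hRf _ hz with h4 | h4
          · rw [h.invol] at h4; exact hfu h4.symm
          · rw [h.invol, hlu] at h4; exact absurd h4 (by simp)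
        simp [hC, hz', ← hzz, hfz]
      · intro u _; exact h.invol u
    have hzC : z ∈ C := by simp [hC, hRl z hz]
    rw [← Finset.add_sum_erase C _ hzC, h1] at h0
    exact absurd h0 (by decide)
  choose! y hy1 hy2 using key
  have hle : R.card ≤ (exposed g ∪ U).card := by
    refine Finset.card_le_card_of_injOn (fun z => g (y z)) ?_ ?_
    · intro z hz
      rcases hy2 z hz with h1 | h1
      · simp [h1]
      · simp [hU, h1]
    · intro z hz z' hz' heq
      have := hginj heq
      have h1 := hy1 z hz
      rw [this, hy1 z' hz'] at h1
      exact (Option.some.inj h1).symm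
  have := Finset.card_union_le (exposed g) U
  omega

/-- Strong duality (the Tutte-Berge formula): every maximum matching has a certificate. A vertex
covered by all maximum matchings is removed and put into the barrier; if there is none, Gallai's
lemma says that the connected components are the classes. -/
lemma IsMaxMatchingMap.exists_cert (G : SimpleGraph V) (f : V → V) (hf : IsMaxMatchingMap G f) :
    ∃ l, IsMatchingCert G f l := by
  classical
  induction hn : G.edgeFinset.card using Nat.strong_induction_on generalizing G f with
  | _ n ih =>
  by_cases hG : ∀ w, ∃ g, IsMaxMatchingMap G g ∧ g w = w
  · -- each vertex is labelled with the unmatched vertex of its component, if there is one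
    let r : G.ConnectedComponent → V := fun c =>
      if h : ∃ u, f u = u ∧ G.connectedComponentMk u = c then h.choose else c.out
    refine ⟨fun u => some (r (G.connectedComponentMk u)), hf.toIsMatchingMap, ?_, ?_, ?_⟩
    · intro u hu
      have h : ∃ u', f u' = u' ∧ G.connectedComponentMk u' = G.connectedComponentMk u := ⟨u, hu, rfl⟩
      simp only [r, dif_pos h, Option.some.injEq]
      by_contra hne
      obtain ⟨p⟩ := ConnectedComponent.exact h.choose_spec.2
      exact IsMaxMatchingMap.not_exposed_of_reachable hG p f hf hne h.choose_spec.1 hu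
    · intro u _ h; simp at h
    · intro u w z z' hadj hz hz'
      have : G.connectedComponentMk u = G.connectedComponentMk w :=
        ConnectedComponent.sound hadj.reachable
      simp only [this] at hz
      exact Option.some.inj (hz.symm.trans hz')
  · push Not at hG
    obtain ⟨v, hv⟩ := hG
    have hfv := hv f hf
    set w := f v with hw
    have hfw : f w = v := hf.invol v
    have hvw : G.Adj v w := hf.adj v hfv
    set G' := G.deleteIncidenceSet v with hG'
    have hadj' : ∀ a b, G'.Adj a b ↔ G.Adj a b ∧ a ≠ v ∧ b ≠ v := fun a b =>
      deleteIncidenceSet_adj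
    set f' : V → V := fun a => if a = v then v else if a = w then w else f a with hf'
    have hm' : IsMatchingMap G' f' := by
      refine ⟨fun a => ?_, fun a ha => ?_⟩
      · have h := hf.invol a
        simp only [hf']
        grind
      · have h := hf.adj a
        have h2 := hf.invol a
        rw [hadj']
        simp only [hf'] at ha ⊢
        grind
    have hexp : (exposed f').card ≤ (exposed f).card + 2 := by
      have : exposed f' ⊆ insert v (insert w (exposed f)) := by
        intro a
        simp only [mem_exposed, hf', Finset.mem_insert]
        grind
      have h1 := Finset.card_le_card this
      have h2 := Finset.card_insert_le v (insert w (exposed f))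
      have h3 := Finset.card_insert_le w (exposed f)
      omega
    have hpar : ∀ k : V → V, (∀ a, k (k a) = a) → 
        ((exposed k).card : ZMod 2) = (Fintype.card V : ZMod 2) := by
      intro k hk
      have h0 : (∑ _u ∈ (exposed k)ᶜ, (1 : ZMod 2)) = 0 := by
        refine Finset.sum_involution (fun u _ => k u) ?_ ?_ ?_ ?_
        · intro u _; decide
        · intro u hu _; simpa using hu
        · intro u hu
          simp only [Finset.mem_compl, mem_exposed] at hu ⊢
          rw [hk]; exact fun h => hu h.symm
        · intro u _; exact hk u
      rw [← Finset.card_add_card_compl (exposed k)]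
      push_cast
      simp only [Finset.sum_const, nsmul_eq_mul, mul_one] at h0
      rw [h0, add_zero]
    -- by parity, a larger matching of `G - v` would be a maximum matching of `G` missing `v`
    have hmax' : IsMaxMatchingMap G' f' := by
      refine ⟨hm', fun k hk => ?_⟩
      by_contra! hlt
      have hkG : IsMatchingMap G k := ⟨hk.invol, fun u hu => ((hadj' _ _).1 (hk.adj u hu)).1⟩
      have h1 := hpar k hk.invol
      rw [← hpar f hf.invol, ZMod.natCast_eq_natCast_iff'] at h1
      have h2 := hf.card_le k hkG
      have h3 : (exposed k).card = (exposed f).card := by omega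
      refine hv k ⟨hkG, fun j hj => h3 ▸ hf.card_le j hj⟩ ?_
      by_contra hkv
      exact ((hadj' _ _).1 (hk.adj v hkv)).2.1 rfl
    have hcard : G'.edgeFinset.card < n := by
      rw [← hn]
      apply Finset.card_lt_card
      rw [edgeFinset_ssubset_edgeFinset]
      refine lt_of_le_of_ne (G.deleteIncidenceSet_le v) fun h => ?_
      have := (hadj' v w).1 (h ▸ hvw)
      exact this.2.1 rfl
    obtain ⟨l, hl⟩ := ih _ hcard G' f' hmax' (by convert rfl)
    have hlw : l w = some w := hl.unmatched w (by simp only [hf']; grind)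
    refine ⟨fun a => if a = v then none else l a, hf.toIsMatchingMap, ?_, ?_, ?_⟩
    · intro u hu
      have := hl.unmatched u
      simp only [hf'] at this ⊢
      grind
    · intro u hu hlu
      have := hl.barrier u
      have h2 := hf.invol u
      simp only [hf'] at this hlu ⊢
      grind
    · intro a b z z' hab ha hb
      have := hl.noCross a b z z'
      rw [hadj'] at this
      grind

end SimpleGraph

/-! ### The matching number -/

namespace GraphStream

open SimpleGraph

variable {V : Type*} [Fintype V] [DecidableEq V] {G : SimpleGraph V} {f : V → V}

lemma two_mul_ncard_edgeSet_add_card_exposed {M : G.Subgraph}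
    (hM : ∀ u w, M.Adj u w ↔ f u = w ∧ f u ≠ u) :
    2 * M.edgeSet.ncard + (exposed f).card = Fintype.card V := by
  classical
  have h := M.spanningCoe.sum_degrees_eq_twice_card_edges
  have h1 : M.spanningCoe.edgeFinset.card = M.edgeSet.ncard := by
    rw [← Set.ncard_coe_finset, coe_edgeFinset]; rfl
  have h2 : ∀ u, M.spanningCoe.degree u = if f u ≠ u then 1 else 0 := by
    intro u
    rw [← card_neighborFinset_eq_degree]
    split_ifs with hu
    · rw [Finset.card_eq_one]
      refine ⟨f u, ?_⟩
      ext w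
      simp [hM, hu, eq_comm]
    · rw [Finset.card_eq_zero]
      ext w
      simp [hM, hu]
  rw [h1] at h
  rw [← h, Finset.sum_congr rfl fun u _ => h2 u, Finset.sum_boole, Nat.cast_id, add_comm]
  exact Finset.card_filter_add_card_filter_not (s := Finset.univ) fun u => f u = u

lemma exists_isMatchingMap_of_isMatching {M : G.Subgraph} (hM : M.IsMatching) :
    ∃ f : V → V, IsMatchingMap G f ∧ 2 * M.edgeSet.ncard + (exposed f).card = Fintype.card V := by
  classical
  let f : V → V := fun u => if h : ∃ w, M.Adj u w then h.choose else u
  have hf : ∀ u w, M.Adj u w → f u = w := by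
    intro u w h
    have h' : ∃ w, M.Adj u w := ⟨w, h⟩
    simp only [f, dif_pos h']
    exact hM.eq_of_adj_left h'.choose_spec h
  have hf' : ∀ u, f u ≠ u → M.Adj u (f u) := by
    intro u hu
    by_cases h' : ∃ w, M.Adj u w
    · simp only [f, dif_pos h']; exact h'.choose_spec
    · simp [f, dif_neg h'] at hu
  refine ⟨f, ⟨fun u => ?_, fun u hu => (hf' u hu).adj_sub⟩, ?_⟩
  · by_cases hu : f u = u
    · rw [hu, hu]
    · exact hf _ _ (hf' u hu).symm
  · refine two_mul_ncard_edgeSet_add_card_exposed fun u w => ⟨fun h => ?_, fun h => ?_⟩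
    · have := hf u w h
      exact ⟨this, this ▸ h.ne.symm⟩
    · exact h.1 ▸ hf' u h.2

lemma exists_isMatching_of_isMatchingMap (hf : IsMatchingMap G f) :
    ∃ M : G.Subgraph, M.IsMatching ∧
      2 * M.edgeSet.ncard + (exposed f).card = Fintype.card V := by
  let M : G.Subgraph :=
    { verts := {u | f u ≠ u}
      Adj := fun u w => f u = w ∧ f u ≠ u
      adj_sub := by rintro u w ⟨rfl, h⟩; exact hf.adj u h
      edge_vert := by rintro u w ⟨rfl, h⟩; exact h
      symm := ⟨by rintro u w ⟨rfl, h⟩; exact ⟨hf.invol u, by rw [hf.invol]; exact h.symm⟩⟩ }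
  refine ⟨M, fun u hu => ⟨f u, ⟨rfl, hu⟩, fun w hw => hw.1.symm⟩, ?_⟩
  exact two_mul_ncard_edgeSet_add_card_exposed fun u w => Iff.rfl

lemma two_mul_matchingNumber_add_card_exposed (hf : IsMaxMatchingMap G f) :
    2 * matchingNumber G + (exposed f).card = Fintype.card V := by
  obtain ⟨M, hM, hMc⟩ := exists_isMatching_of_isMatchingMap hf.toIsMatchingMap
  have hgr : IsGreatest {k | ∃ M : G.Subgraph, M.IsMatching ∧ M.edgeSet.ncard = k}
      M.edgeSet.ncard := by
    refine ⟨⟨M, hM, rfl⟩, ?_⟩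
    rintro k ⟨M', hM', rfl⟩
    obtain ⟨g, hg, hgc⟩ := exists_isMatchingMap_of_isMatching hM'
    have := hf.card_le g hg
    omega
  rw [matchingNumber, hgr.csSup_eq, hMc]

end GraphStream

/-! ### Short bit strings -/

namespace GraphStream

lemma card_lists_length_lt_le (L : ℕ) :
    Nat.card {l : List Bool // l.length < L} ≤ L * 2 ^ L := by
  let φ : {l : List Bool // l.length < L} → Fin L × (Fin L → Bool) := fun l =>
    (⟨l.1.length, l.2⟩, fun i => l.1.getD i false)
  have hφ : Function.Injective φ := by
    rintro ⟨l, hl⟩ ⟨l', hl'⟩ h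
    simp only [φ, Prod.mk.injEq, Fin.mk.injEq] at h
    refine Subtype.ext (List.ext_getElem h.1 fun i h1 h2 => ?_)
    have := congrFun h.2 ⟨i, h1.trans hl⟩
    simpa only [List.getD_eq_getElem _ _ h1, List.getD_eq_getElem _ _ h2] using this
  have := Nat.card_le_card_of_injective φ hφ
  simpa using this

instance finite_lists_length_lt (L : ℕ) : Finite {l : List Bool // l.length < L} :=
  List.finite_length_lt Bool L

/-! ### Amplification and the one-way complexity of the index problem -/

section Index

open Finset

/-- A Chernoff-type bound: among `2 q` independent events of probability at most `1/3`, at least `q`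
happen with probability at most `(8/9)^q`. It is Markov's inequality for `2 ^ X`, where `X` is the
number of events that happen. -/
lemma card_majority_le {Ω : Type*} [Fintype Ω] (p : Ω → Prop) [DecidablePred p]
    (hp : 3 * #{R | p R} ≤ Fintype.card Ω) (q : ℕ) :
    9 ^ q * #{R : Fin (2 * q) → Ω | q ≤ #{l | p (R l)}} ≤ 8 ^ q * Fintype.card Ω ^ (2 * q) := by
  have h1 : 2 ^ q * #{R : Fin (2 * q) → Ω | q ≤ #{l | p (R l)}}
      ≤ ∑ R : Fin (2 * q) → Ω, ∏ l, if p (R l) then 2 else 1 := by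
    rw [mul_comm, ← smul_eq_mul, ← Finset.sum_const]
    refine (Finset.sum_le_sum fun R hR => ?_).trans
      (Finset.sum_le_sum_of_subset (Finset.filter_subset _ _))
    simp only [mem_filter, mem_univ, true_and] at hR
    rw [Finset.prod_ite]
    simp only [prod_const, one_pow, mul_one]
    exact Nat.pow_le_pow_right (by norm_num) hR
  have h2 : ∑ R : Fin (2 * q) → Ω, ∏ l, (if p (R l) then 2 else 1)
      = (Fintype.card Ω + #{R | p R}) ^ (2 * q) := by
    rw [← Fintype.sum_pow (fun R : Ω => if p R then 2 else 1)]
    congr 1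
    have : ∀ R : Ω, (if p R then 2 else 1) = 1 + if p R then 1 else 0 := by
      intro R; split_ifs <;> rfl
    simp [this, Finset.sum_add_distrib]
  have h3 : 9 ^ q * (Fintype.card Ω + #{R | p R}) ^ (2 * q)
      ≤ 16 ^ q * Fintype.card Ω ^ (2 * q) := by
    have e1 : 9 ^ q * (Fintype.card Ω + #{R | p R}) ^ (2 * q)
        = (3 * (Fintype.card Ω + #{R | p R})) ^ (2 * q) := by
      rw [mul_pow, pow_mul 3]; norm_num
    have e2 : 16 ^ q * Fintype.card Ω ^ (2 * q) = (4 * Fintype.card Ω) ^ (2 * q) := by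
      rw [mul_pow, pow_mul 4]; norm_num
    rw [e1, e2]
    exact Nat.pow_le_pow_left (by omega) _
  have h4 : 2 ^ q * (9 ^ q * #{R : Fin (2 * q) → Ω | q ≤ #{l | p (R l)}})
      ≤ 2 ^ q * (8 ^ q * Fintype.card Ω ^ (2 * q)) := by
    calc _ = 9 ^ q * (2 ^ q * #{R : Fin (2 * q) → Ω | q ≤ #{l | p (R l)}}) := by ring
      _ ≤ 9 ^ q * (Fintype.card Ω + #{R | p R}) ^ (2 * q) := by
          rw [← h2]; exact Nat.mul_le_mul_left _ h1
      _ ≤ 16 ^ q * Fintype.card Ω ^ (2 * q) := h3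
      _ = _ := by rw [← mul_assoc, ← mul_pow]; norm_num
  exact Nat.le_of_mul_le_mul_left h4 (by positivity)

/-- The index problem needs messages of linear length: if every bit of `x` can be recovered from the
message with error at most `1/16`, there are `2 ^ Ω(N)` messages. For the best choice of the coins
the average Hamming distance `d` between `x` and what is decoded is at most `N / 16`, so the sum of
`4 ^ (-d)` over all `x` is at least `2 ^ N * 4 ^ (- N / 16)`; but a single message contributes at
most `(5/4) ^ N` to this sum. -/
lemma index_lower_bound {ι Msg Ω : Type*} [Fintype ι] [Fintype Msg] [Fintype Ω]
    [Nonempty Ω] (enc : Ω → (ι → Bool) → Msg) (dec : Ω → Msg → ι → Bool)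
    (h : ∀ x i, 16 * #{R | dec R (enc R x) i ≠ x i} ≤ Fintype.card Ω) :
    (Fintype.card ι : ℝ) / 4 ≤ Real.log (Fintype.card Msg) := by
  classical
  set N := Fintype.card ι with hN
  obtain ⟨R, hR⟩ : ∃ R, 16 * ∑ x : ι → Bool, #{i | dec R (enc R x) i ≠ x i} ≤ N * 2 ^ N := by
    by_contra! hcon
    have h1 : ∑ R : Ω, N * 2 ^ N < ∑ R : Ω, 16 * ∑ x : ι → Bool, #{i | dec R (enc R x) i ≠ x i} :=
      Finset.sum_lt_sum_of_nonempty univ_nonempty fun R _ => hcon R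
    have h2 : ∑ R : Ω, 16 * ∑ x : ι → Bool, #{i | dec R (enc R x) i ≠ x i}
        = ∑ x : ι → Bool, ∑ i, 16 * #{R | dec R (enc R x) i ≠ x i} := by
      simp only [Finset.card_filter, Finset.mul_sum]
      rw [Finset.sum_comm]
      refine Finset.sum_congr rfl fun x _ => ?_
      rw [Finset.sum_comm]
    have h3 : ∑ x : ι → Bool, ∑ i, 16 * #{R | dec R (enc R x) i ≠ x i}
        ≤ ∑ x : ι → Bool, ∑ _i : ι, Fintype.card Ω :=
      Finset.sum_le_sum fun x _ => Finset.sum_le_sum fun i _ => h x i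
    rw [h2] at h1
    have h4 := h1.trans_le h3
    simp only [sum_const, card_univ, smul_eq_mul, Fintype.card_fun, Fintype.card_bool, ← hN] at h4
    exact absurd h4 (by rw [not_lt]; apply le_of_eq; ring)
  set d : (ι → Bool) → ℕ := fun x => #{i | dec R (enc R x) i ≠ x i} with hd
  set w : Msg → (ι → Bool) → ℝ := fun m x => ∏ i, if dec R m i ≠ x i then 1 / 4 else 1 with hw
  have hw0 : ∀ m x, 0 ≤ w m x := fun m x => Finset.prod_nonneg fun i _ => by split_ifs <;> norm_num
  have hsum : ∀ m, ∑ x, w m x = (5 / 4) ^ N := by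
    intro m
    have : ∀ i, ∑ b : Bool, (if dec R m i ≠ b then (1 / 4 : ℝ) else 1) = 5 / 4 := by
      intro i; cases dec R m i <;> norm_num
    rw [hw, ← Fintype.prod_sum fun i b => if dec R m i ≠ b then (1 / 4 : ℝ) else 1]
    simp only [this, prod_const, card_univ, hN]
  have hup : ∑ x, w (enc R x) x ≤ Fintype.card Msg * (5 / 4) ^ N := by
    calc _ ≤ ∑ x, ∑ m, w m x := Finset.sum_le_sum fun x _ =>
          Finset.single_le_sum (fun m _ => hw0 m x) (mem_univ (enc R x))
      _ = _ := by rw [Finset.sum_comm, Finset.sum_congr rfl fun m _ => hsum m]; simp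
  have hlog4 : Real.log (1 / 4) = -(2 * Real.log 2) := by
    rw [one_div, Real.log_inv, show (4 : ℝ) = 2 ^ 2 by norm_num, Real.log_pow]; norm_num
  -- convexity: `4 ^ (-d)` lies above its tangent at `d = N / 16`
  have hlow : ∀ x, Real.exp (-(N / 16 * (2 * Real.log 2)))
      * (1 - (d x - N / 16) * (2 * Real.log 2)) ≤ w (enc R x) x := by
    intro x
    have h1 : w (enc R x) x = Real.exp (-(d x * (2 * Real.log 2))) := by
      simp only [hw]
      rw [Finset.prod_ite]
      simp only [prod_const, one_pow, mul_one]
      rw [← Real.exp_log (show (0 : ℝ) < (1 / 4) ^ #{i | dec R (enc R x) i ≠ x i} by positivity),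
        Real.log_pow, hlog4]
      congr 1; ring
    have h2 : -(d x * (2 * Real.log 2)) = -(N / 16 * (2 * Real.log 2))
        + -((d x - N / 16) * (2 * Real.log 2)) := by ring
    rw [h1, h2, Real.exp_add]
    refine mul_le_mul_of_nonneg_left ?_ (Real.exp_pos _).le
    have := Real.add_one_le_exp (-(((d x : ℝ) - N / 16) * (2 * Real.log 2)))
    linarith
  have hlow' : Real.exp (-(N / 16 * (2 * Real.log 2))) * 2 ^ N ≤ ∑ x, w (enc R x) x := by
    refine le_trans ?_ (Finset.sum_le_sum fun x _ => hlow x)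
    rw [← Finset.mul_sum]
    refine mul_le_mul_of_nonneg_left ?_ (Real.exp_pos _).le
    rw [Finset.sum_sub_distrib, ← Finset.sum_mul, Finset.sum_sub_distrib]
    have h1 : (16 : ℝ) * ∑ x, (d x : ℝ) ≤ N * 2 ^ N := by exact_mod_cast hR
    have h2 : (0 : ℝ) ≤ 2 * Real.log 2 := by positivity
    simp only [sum_const, card_univ, Fintype.card_fun, Fintype.card_bool, ← hN, nsmul_eq_mul]
    push_cast
    nlinarith
  have hall := hlow'.trans hup
  have hM : (0 : ℝ) < Fintype.card Msg := by
    have : Nonempty Msg := ⟨enc R fun _ => true⟩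
    exact_mod_cast Fintype.card_pos
  have hlg := Real.log_le_log (by positivity) hall
  rw [Real.log_mul (by positivity) (by positivity), Real.log_mul (by positivity) (by positivity),
    Real.log_exp, Real.log_pow, Real.log_pow] at hlg
  have h5 : Real.log (5 / 4) ≤ 1 / 4 := by
    have := Real.log_le_sub_one_of_pos (show (0 : ℝ) < 5 / 4 by norm_num)
    linarith
  have h2 := Real.log_two_gt_d9
  have hN0 : (0 : ℝ) ≤ N := by positivity
  nlinarith

end Index

/-! ### From schemes to the index problem -/

section Reduction

open Finset

lemma Verifier.three_mul_card_le {n : ℕ} (S : Verifier n) [Fintype S.Coins] (p : S.Coins → Prop)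
    [DecidablePred p] (h : S.prob p ≤ 1 / 3) : 3 * #{R | p R} ≤ Fintype.card S.Coins := by
  have hpos : (0 : ℝ) < Fintype.card S.Coins := by
    have := S.coins_nonempty
    exact_mod_cast Fintype.card_pos
  rw [Verifier.prob, Nat.card_eq_fintype_card, Nat.card_eq_fintype_card, Fintype.card_subtype,
    div_le_iff₀ hpos] at h
  have : (3 * #{R | p R} : ℝ) ≤ Fintype.card S.Coins := by linarith
  exact_mod_cast this

lemma scaled_le_of_mul_le {a b c e K : ℕ} (ha : 0 < a) (h : c * b ≤ a) (h' : a * e ≤ b * K) :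
    c * e ≤ K := by
  refine Nat.le_of_mul_le_mul_left ?_ ha
  calc a * (c * e) = c * (a * e) := by ring
    _ ≤ c * (b * K) := Nat.mul_le_mul_left _ h'
    _ = (c * b) * K := by ring
    _ ≤ a * K := Nat.mul_le_mul_right _ h

lemma log_card_fun_le {Mem : Type*} [Fintype Mem] [Nonempty Mem] (k : ℕ) {v : ℕ}
    (h : Fintype.card Mem ≤ 2 ^ v) : Real.log (Fintype.card (Fin k → Mem)) ≤ k * v := by
  rw [Fintype.card_fun, Fintype.card_fin, Nat.cast_pow, Real.log_pow]
  have hpos : (0 : ℝ) < Fintype.card Mem := by exact_mod_cast Fintype.card_pos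
  have h1 : Real.log (Fintype.card Mem) ≤ v * Real.log 2 := by
    rw [← Real.log_pow]
    exact Real.log_le_log hpos (by exact_mod_cast h)
  have h2 : Real.log (Fintype.card Mem) ≤ v := by
    have := Real.log_two_lt_d9
    have : (0 : ℝ) ≤ v := by positivity
    nlinarith
  exact mul_le_mul_of_nonneg_left h2 (by positivity)

/-- Streams that encode the index problem on `ι` give a lower bound on `h * v`. Repeating the
summary `2 q = O(h)` times makes the error so small that a union bound over all proof strings is
affordable; the bit is then decoded by trying all proof strings. -/
lemma Verifier.IsScheme.card_le_of_index {n h v : ℕ} {S : Verifier n}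
    {valid : List (EdgeUpdate n) → Prop} {F : List (EdgeUpdate n) → ℕ}
    (hS : S.IsScheme valid F (1 / 3) (1 / 3) h v) (hh : 1 ≤ h) {ι : Type*} [Fintype ι]
    (σ : (ι → Bool) → List (EdgeUpdate n)) (τ : ι → List (EdgeUpdate n)) (val : ι → Bool → ℕ)
    (hvalid : ∀ x i, valid (σ x ++ τ i)) (hval : ∀ x i, F (σ x ++ τ i) = val i (x i))
    (hne : ∀ i, val i true ≠ val i false) :
    (Fintype.card ι : ℝ) ≤ 384 * (h * v) := by
  classical
  have := S.coins_finite
  have := S.mem_finite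
  have := S.coins_nonempty
  have : Fintype S.Coins := Fintype.ofFinite _
  have : Fintype S.Mem := Fintype.ofFinite _
  have : Fintype {l : List Bool // l.length < h + 1} := Fintype.ofFinite _
  obtain ⟨q, hq⟩ : ∃ q, q = 12 * (h + 3) := ⟨_, rfl⟩
  let out : S.Coins → S.Mem → ι → List Bool → Option ℕ := fun R m i help =>
    S.out R ((τ i).foldl (S.readToken R) m) help
  have hout : ∀ R x i help, out R (S.summary R (σ x)) i help
      = S.out R (S.summary R (σ x ++ τ i)) help := by
    intro R x i help
    simp only [out, Verifier.summary, List.foldl_append]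
  let enc : (Fin (2 * q) → S.Coins) → (ι → Bool) → (Fin (2 * q) → S.Mem) := fun R x k =>
    S.summary (R k) (σ x)
  let good : (Fin (2 * q) → S.Coins) → (Fin (2 * q) → S.Mem) → ι → List Bool → ℕ :=
    fun R m i help => #{k | out (R k) (m k) i help = some (val i true)}
  let dec : (Fin (2 * q) → S.Coins) → (Fin (2 * q) → S.Mem) → ι → Bool := fun R m i =>
    decide (∃ help : {l : List Bool // l.length < h + 1}, q ≤ good R m i help)
  have hpow : 16 * (4 ^ (h + 1) * 8 ^ q) ≤ 9 ^ q := by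
    calc 16 * (4 ^ (h + 1) * 8 ^ q) = (4 * 8 ^ 12) ^ (h + 3) := by
          rw [mul_pow, ← pow_mul, ← hq, show h + 3 = (h + 1) + 2 by ring, pow_add]; ring
      _ ≤ (9 ^ 12) ^ (h + 3) := Nat.pow_le_pow_left (by norm_num) _
      _ = 9 ^ q := by rw [← pow_mul, hq]
  have hkey : ∀ x i, 9 ^ q * #{R | dec R (enc R x) i ≠ x i}
      ≤ 4 ^ (h + 1) * (8 ^ q * Fintype.card (Fin (2 * q) → S.Coins)) := by
    intro x i
    rw [Fintype.card_fun, Fintype.card_fin]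
    cases hx : x i with
    | true =>
      obtain ⟨help, hlen, hc⟩ := hS.complete _ (hvalid x i)
      have hbad : 3 * #{R | ¬ S.out R (S.summary R (σ x ++ τ i)) help = some (val i true)}
          ≤ Fintype.card S.Coins := by
        apply S.three_mul_card_le
        have hpos : (0 : ℝ) < Fintype.card S.Coins := by exact_mod_cast Fintype.card_pos
        rw [hval, hx, Verifier.prob, Nat.card_eq_fintype_card, Nat.card_eq_fintype_card,
          le_div_iff₀ hpos] at hc
        rw [Verifier.prob, Nat.card_eq_fintype_card, Nat.card_eq_fintype_card, div_le_iff₀ hpos,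
          Fintype.card_subtype_compl, Nat.cast_sub (Fintype.card_subtype_le _)]
        linarith
      have hm := card_majority_le _ hbad q
      refine le_trans (Nat.mul_le_mul_left _ (Finset.card_le_card ?_)) (hm.trans
        (Nat.le_mul_of_pos_left _ (by positivity)))
      intro R hR
      simp only [dec, mem_filter, mem_univ, true_and, ne_eq, decide_eq_true_eq, not_exists,
        not_le] at hR
      have h1 := hR ⟨help, by omega⟩
      simp only [mem_filter, mem_univ, true_and]
      simp only [good, enc, hout] at h1
      have h2 := Finset.card_filter_add_card_filter_not (s := (univ : Finset (Fin (2 * q))))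
        fun k => S.out (R k) (S.summary (R k) (σ x ++ τ i)) help = some (val i true)
      rw [card_univ, Fintype.card_fin] at h2
      omega
    | false =>
      have hbad : ∀ help : List Bool,
          3 * #{R | S.out R (S.summary R (σ x ++ τ i)) help = some (val i true)}
          ≤ Fintype.card S.Coins := by
        intro help
        refine le_trans ?_ (S.three_mul_card_le _ (hS.sound _ (hvalid x i) help))
        refine Nat.mul_le_mul_left _ (Finset.card_le_card ?_)
        intro R hR
        simp only [mem_filter, mem_univ, true_and] at hR ⊢
        rw [hR, hval, hx]
        simp [hne i]
      have hsub : ({R | dec R (enc R x) i ≠ false} : Finset (Fin (2 * q) → S.Coins)) ⊆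
          (univ : Finset {l : List Bool // l.length < h + 1}).biUnion fun help =>
            {R | q ≤ #{k | S.out (R k) (S.summary (R k) (σ x ++ τ i)) help.1
              = some (val i true)}} := by
        intro R hR
        simpa [dec, good, enc, hout] using hR
      have hcard : Fintype.card {l : List Bool // l.length < h + 1} ≤ 4 ^ (h + 1) := by
        have h1 := card_lists_length_lt_le (h + 1)
        rw [Nat.card_eq_fintype_card] at h1
        refine h1.trans ?_
        rw [show 4 = 2 * 2 by rfl, mul_pow]
        exact Nat.mul_le_mul_right _ Nat.lt_two_pow_self.le
      calc _ ≤ 9 ^ q * ∑ help : {l : List Bool // l.length < h + 1},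
            #{R : Fin (2 * q) → S.Coins | q ≤ #{k | S.out (R k) (S.summary (R k) (σ x ++ τ i)) help.1
              = some (val i true)}} :=
            Nat.mul_le_mul_left _ ((Finset.card_le_card hsub).trans Finset.card_biUnion_le)
        _ ≤ ∑ _help : {l : List Bool // l.length < h + 1},
            8 ^ q * Fintype.card S.Coins ^ (2 * q) := by
            rw [Finset.mul_sum]
            exact Finset.sum_le_sum fun help _ => card_majority_le _ (hbad help) q
        _ ≤ _ := by
            rw [Finset.sum_const, card_univ, smul_eq_mul]
            exact Nat.mul_le_mul_right _ hcard
  have hind := index_lower_bound enc dec fun x i => by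
    have h1 := hkey x i
    exact scaled_le_of_mul_le (by positivity) hpow (h1.trans_eq (mul_assoc _ _ _).symm)
  have hmem : Real.log (Fintype.card (Fin (2 * q) → S.Mem)) ≤ (2 * q : ℕ) * v := by
    have hsp := hS.space
    rw [Verifier.SpaceAtMost, Nat.card_eq_fintype_card] at hsp
    have : Nonempty S.Mem := ⟨S.start (Classical.arbitrary _)⟩
    exact log_card_fun_le _ hsp
  push_cast at hmem
  have h1 : (h : ℝ) ≥ 1 := by exact_mod_cast hh
  have h2 : (q : ℝ) = 12 * (h + 3) := by rw [hq]; push_cast; ring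
  have h3 : (0 : ℝ) ≤ v := by positivity
  rw [h2] at hmem
  nlinarith [mul_le_mul_of_nonneg_right h1 h3]

end Reduction

end GraphStream

/-! ### Streams of simple graphs -/

namespace GraphStream

open SimpleGraph

variable {n : ℕ}

lemma edgeMult_cons (a : EdgeUpdate n) (σ : List (EdgeUpdate n)) (e : Sym2 (Fin n)) :
    edgeMult (a :: σ) e = (if s(a.u, a.v) = e then a.Δ else 0) + edgeMult σ e := by
  simp [edgeMult]

lemma edgeMult_append (σ τ : List (EdgeUpdate n)) (e : Sym2 (Fin n)) :
    edgeMult (σ ++ τ) e = edgeMult σ e + edgeMult τ e := by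
  simp [edgeMult]

lemma edgeMult_diag (σ : List (EdgeUpdate n)) (u : Fin n) : edgeMult σ s(u, u) = 0 := by
  refine List.sum_eq_zero fun x hx => ?_
  obtain ⟨a, -, rfl⟩ := List.mem_map.1 hx
  rw [if_neg]
  intro h
  have := a.ne
  simp only [Sym2.eq_iff] at h
  grind

lemma graphOf_adj {σ : List (EdgeUpdate n)} {u w : Fin n} :
    (graphOf σ).Adj u w ↔ 0 < edgeMult σ s(u, w) := by
  rw [graphOf, fromEdgeSet_adj, Set.mem_ofPred_eq]
  refine ⟨fun h => h.1, fun h => ⟨h, ?_⟩⟩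
  rintro rfl
  rw [edgeMult_diag] at h
  exact lt_irrefl _ h

/-- The insertion of the edge between the ends of a dart. -/
def insertDart {G : SimpleGraph (Fin n)} (d : G.Dart) : EdgeUpdate n := ⟨d.fst, d.snd, d.adj.ne, 1⟩

/-- A stream inserting each edge of `G` once, in some order and with some orientation. -/
noncomputable def streamOf (G : SimpleGraph (Fin n)) : List (EdgeUpdate n) :=
  open Classical in
  G.edgeFinset.toList.attach.map fun e => insertDart (G := G)
    ⟨e.1.out, by
      have h : e.1 ∈ G.edgeSet := by simpa using e.2
      rw [← mem_edgeSet]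
      rwa [show s(e.1.out.1, e.1.out.2) = e.1 from Quot.out_eq e.1]⟩

lemma edgeMult_streamOf (G : SimpleGraph (Fin n)) (e : Sym2 (Fin n)) [Decidable (e ∈ G.edgeSet)] :
    edgeMult (streamOf G) e = if e ∈ G.edgeSet then 1 else 0 := by
  classical
  have h1 : edgeMult (streamOf G) e
      = (G.edgeFinset.toList.map fun e' => if e' = e then (1 : ℤ) else 0).sum := by
    rw [edgeMult, streamOf, List.map_map, ← List.attach_map_val (l := G.edgeFinset.toList)]
    congr 1
    refine List.map_congr_left fun e' _ => ?_
    simp only [Function.comp, insertDart]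
    have : s(e'.1.out.1, e'.1.out.2) = e'.1 := Quot.out_eq e'.1
    refine if_congr ?_ rfl rfl
    rw [this]
  rw [h1, Finset.sum_map_toList, Finset.sum_ite_eq' G.edgeFinset e fun _ => (1 : ℤ)]
  simp only [mem_edgeFinset]

lemma streamOf_delta (G : SimpleGraph (Fin n)) : ∀ a ∈ streamOf G, a.Δ = 1 := by
  intro a ha
  rw [streamOf] at ha
  obtain ⟨e, -, rfl⟩ := List.mem_map.1 ha
  rfl

lemma isInsertionStream_streamOf_append {G G' : SimpleGraph (Fin n)}
    (h : ∀ u w, G.Adj u w → ¬ G'.Adj u w) : IsInsertionStream (streamOf G ++ streamOf G') := by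
  classical
  refine ⟨fun a ha => ?_, fun e => ?_⟩
  · rcases List.mem_append.1 ha with ha | ha
    exacts [streamOf_delta _ _ ha, streamOf_delta _ _ ha]
  · induction e with | _ u w => ?_
    rw [edgeMult_append, edgeMult_streamOf, edgeMult_streamOf]
    have := h u w
    simp only [mem_edgeSet]
    split_ifs <;> simp_all

lemma graphOf_streamOf_append (G G' : SimpleGraph (Fin n)) :
    graphOf (streamOf G ++ streamOf G') = G ⊔ G' := by
  classical
  ext u w
  rw [graphOf_adj, edgeMult_append, edgeMult_streamOf, edgeMult_streamOf, sup_adj]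
  simp only [mem_edgeSet]
  split_ifs <;> simp_all

/-! ### Matchings that decide the index problem -/

section Gadget

variable (n m : ℕ)

/-- The bipartite graph of the bits `x`: the edge between `a` and `m + b` is present if
`x (a, b)` is set. -/
def bitGraph (x : Fin m × Fin m → Bool) : SimpleGraph (Fin n) :=
  fromRel fun u w => ∃ a b : Fin m, x (a, b) = true ∧ u.val = a ∧ w.val = m + b

variable (i j : ℕ)

/-- The pendant edges attached to all vertices `a ≠ i` and `m + b ≠ m + j` of the two sides of
`bitGraph`. The ends of degree one are `2 m, …, 4 m - 3`. -/
def PendantRel (u w : ℕ) : Prop :=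
  (u < i ∧ w = 2 * m + u) ∨ (i < u ∧ u < m ∧ w + 1 = 2 * m + u) ∨
  (m ≤ u ∧ u < m + j ∧ w + 1 = 2 * m + u) ∨ (m + j < u ∧ u < 2 * m ∧ w + 2 = 2 * m + u)

/-- The graph of the pendant edges. -/
def pendantGraph : SimpleGraph (Fin n) := fromRel fun u w => PendantRel m i j u w

variable {n m i j}

/-- A maximum matching of `bitGraph ⊔ pendantGraph`: all pendant edges, and the edge between `i` and
`m + j` if it is present, which is what `β` says. -/
def gadgetMate (m i j : ℕ) (β : Bool) (u : ℕ) : ℕ :=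
  if u < m then
    if u < i then 2 * m + u else if i < u then 2 * m + u - 1 else if β then m + j else u
  else if u < 2 * m then
    if u < m + j then 2 * m + u - 1 else if m + j < u then 2 * m + u - 2 else if β then i else u
  else if u < 3 * m - 1 then if u - 2 * m < i then u - 2 * m else u - 2 * m + 1
  else if u < 4 * m - 2 then if u - 2 * m + 1 < m + j then u - 2 * m + 1 else u - 2 * m + 2
  else u

lemma gadgetMate_lt (hn : 4 * m ≤ n + 2) (hi : i < m) (hj : j < m) (β : Bool) {u : ℕ}
    (hu : u < n) : gadgetMate m i j β u < n := by
  unfold gadgetMate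
  split_ifs <;> omega

lemma gadgetMate_gadgetMate (hi : i < m) (hj : j < m) (β : Bool) (u : ℕ) :
    gadgetMate m i j β (gadgetMate m i j β u) = u := by
  cases β <;> unfold gadgetMate <;> simp only [Bool.false_eq_true, if_false, if_true] <;> grind

lemma adj_of_gadgetMate_ne {β : Bool} {u : ℕ}
    (h : gadgetMate m i j β u ≠ u) :
    (β = true ∧ (u = i ∧ gadgetMate m i j β u = m + j ∨ u = m + j ∧ gadgetMate m i j β u = i)) ∨
      PendantRel m i j u (gadgetMate m i j β u) ∨ PendantRel m i j (gadgetMate m i j β u) u := by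
  obtain ⟨w, hw⟩ : ∃ w, w = gadgetMate m i j β u := ⟨_, rfl⟩
  rw [← hw] at h ⊢
  unfold PendantRel
  unfold gadgetMate at hw
  cases β <;> simp only [Bool.false_eq_true, if_false, if_true] at hw ⊢ <;> split_ifs at hw <;>
    grind

/-- The matching `gadgetMate` on the vertex set `Fin n`. -/
def gadgetMateFin (hn : 4 * m ≤ n + 2) (i j : Fin m) (β : Bool) (u : Fin n) : Fin n :=
  ⟨gadgetMate m i j β u, gadgetMate_lt hn i.2 j.2 β u.2⟩

/-- In the certificate, the barrier consists of the vertices with pendant edges, and the only class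
with more than one vertex is `{i, m + j}`, when the bit is set. -/
lemma isMaxMatchingMap_gadget (hn : 4 * m ≤ n + 2) (x : Fin m × Fin m → Bool) (i j : Fin m) :
    IsMaxMatchingMap (bitGraph n m x ⊔ pendantGraph n m i j)
      (gadgetMateFin hn i j (x (i, j))) := by
  have hi := i.2
  have hj := j.2
  have hin : i.val < n := by omega
  refine IsMatchingCert.isMaxMatchingMap (l := fun u =>
    if u.val < 2 * m ∧ u.val ≠ i ∧ u.val ≠ m + j then none
    else if u.val = m + j ∧ x (i, j) = true then some ⟨i, hin⟩ else some u)
    ⟨⟨fun u => Fin.ext (gadgetMate_gadgetMate hi hj _ _), fun u hu => ?_⟩, fun u hu => ?_,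
    fun u hu hl => ?_, fun u w z z' hadj hz hz' => ?_⟩
  · have h := adj_of_gadgetMate_ne (fun h => hu (Fin.ext h))
    rw [sup_adj, bitGraph, pendantGraph, fromRel_adj, fromRel_adj]
    rcases h with ⟨hx, h⟩ | h
    · refine Or.inl ⟨hu.symm, ?_⟩
      rcases h with h | h
      · exact Or.inl ⟨i, j, hx, h.1, h.2⟩
      · exact Or.inr ⟨i, j, hx, h.2, h.1⟩
    · exact Or.inr ⟨hu.symm, h⟩
  · have hu' := Fin.ext_iff.1 hu
    simp only [gadgetMateFin] at hu'
    unfold gadgetMate at hu'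
    cases hx : x (i, j) <;> simp only [hx, Bool.false_eq_true, if_false, if_true] at * <;>
      grind
  · have hu' : gadgetMate m i j (x (i, j)) u ≠ u := fun h => hu (Fin.ext h)
    have hlu : u.val < 2 * m ∧ u.val ≠ i ∧ u.val ≠ m + j := by
      by_contra hcon
      rw [if_neg hcon] at hl
      split_ifs at hl
    have hge : 2 * m ≤ gadgetMate m i j (x (i, j)) u := by
      unfold gadgetMate
      split_ifs <;> omega
    have hsome : ∀ k : Fin n, 2 * m ≤ k.val →
        (if k.val < 2 * m ∧ k.val ≠ i ∧ k.val ≠ m + j then none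
        else if k.val = m + j ∧ x (i, j) = true then some ⟨i, hin⟩ else some k) = some k := by
      intro k hk
      rw [if_neg (by omega), if_neg (by omega)]
    exact hsome _ hge
  · have hlab : ∀ u z : Fin n, (if u.val < 2 * m ∧ u.val ≠ i ∧ u.val ≠ m + j then none
        else if u.val = m + j ∧ x (i, j) = true then some ⟨i, hin⟩ else some u) = some z →
        ¬ (u.val < 2 * m ∧ u.val ≠ i ∧ u.val ≠ m + j) ∧
          z.val = if u.val = m + j ∧ x (i, j) = true then i.val else u.val := by
      intro u z h
      grind
    obtain ⟨h1, h2⟩ := hlab u z hz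
    obtain ⟨h1', h2'⟩ := hlab w z' hz'
    apply Fin.ext
    rw [sup_adj, bitGraph, pendantGraph, fromRel_adj, fromRel_adj] at hadj
    have hpend : ∀ u w : ℕ, PendantRel m i j u w → u < 2 * m ∧ u ≠ i ∧ u ≠ m + j := by
      intro u w h
      unfold PendantRel at h
      omega
    have hbit : ∀ u w : Fin n, (∃ a b : Fin m, x (a, b) = true ∧ u.val = a ∧ w.val = m + b) →
        ¬ (u.val < 2 * m ∧ u.val ≠ i ∧ u.val ≠ m + j) →
        ¬ (w.val < 2 * m ∧ w.val ≠ i ∧ w.val ≠ m + j) →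
        x (i, j) = true ∧ u.val = i ∧ w.val = m + j := by
      rintro u w ⟨a, b, hx, ha, hb⟩ h h'
      have ha' : a = i := Fin.ext (by omega)
      have hb' : b = j := Fin.ext (by omega)
      subst ha' hb'
      exact ⟨hx, ha, hb⟩
    rcases hadj with ⟨-, h | h⟩ | ⟨-, h | h⟩
    · obtain ⟨hx, hu, hw⟩ := hbit u w h h1 h1'
      grind
    · obtain ⟨hx, hw, hu⟩ := hbit w u h h1' h1
      grind
    · exact absurd (hpend _ _ h) h1
    · exact absurd (hpend _ _ h) h1'

lemma card_exposed_gadget_ne (hn : 4 * m ≤ n + 2) (i j : Fin m) :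
    (exposed (gadgetMateFin hn i j true)).card < (exposed (gadgetMateFin hn i j false)).card := by
  have hi := i.2
  have hj := j.2
  apply Finset.card_lt_card
  rw [Finset.ssubset_iff_of_subset]
  · refine ⟨⟨i, by omega⟩, ?_, ?_⟩
    · simp [gadgetMateFin, gadgetMate]
    · simp [gadgetMateFin, gadgetMate]
      omega
  · intro u
    simp only [mem_exposed, gadgetMateFin, Fin.ext_iff]
    unfold gadgetMate
    simp only [Bool.false_eq_true, if_false, if_true]
    split_ifs <;> omega

/-- The bit `x (i, j)` can be read off from the matching number of `bitGraph ⊔ pendantGraph`. -/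
theorem le_mul_of_isScheme {h v : ℕ} (hn : 4 * m ≤ n + 2) (hh : 1 ≤ h) (S : Verifier n)
    (hS : S.IsScheme IsInsertionStream maxMatching (1 / 3) (1 / 3) h v) :
    (m : ℝ) ^ 2 ≤ 384 * (h * v) := by
  have hval : ∀ (x : Fin m × Fin m → Bool) (i : Fin m × Fin m),
      2 * maxMatching (streamOf (bitGraph n m x) ++ streamOf (pendantGraph n m i.1 i.2))
        + (exposed (gadgetMateFin hn i.1 i.2 (x i))).card = n := by
    intro x i
    rw [maxMatching, graphOf_streamOf_append]
    have := two_mul_matchingNumber_add_card_exposed (isMaxMatchingMap_gadget hn x i.1 i.2)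
    simpa using this
  have := hS.card_le_of_index hh (fun x => streamOf (bitGraph n m x))
    (fun i : Fin m × Fin m => streamOf (pendantGraph n m i.1 i.2))
    (fun i β => (n - (exposed (gadgetMateFin hn i.1 i.2 β)).card) / 2)
    (fun x i => isInsertionStream_streamOf_append fun u w h1 h2 => ?_)
    (fun x i => ?_) (fun i => ?_)
  · simpa [sq] using this
  · rw [bitGraph, fromRel_adj] at h1
    rw [pendantGraph, fromRel_adj] at h2
    unfold PendantRel at h2
    have hi := i.1.2
    have hj := i.2.2
    obtain ⟨-, ⟨a, b, -, ha, hb⟩ | ⟨a, b, -, ha, hb⟩⟩ := h1 <;> omega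
  · have := hval x i
    omega
  · have h1 := hval (fun _ => true) i
    have h2 := hval (fun _ => false) i
    have h3 := card_exposed_gadget_ne hn i.1 i.2
    omega

/-- The lower bound: a scheme for insertion streams needs `h * v = Ω(n ^ 2)`. -/
theorem lower_bound {h v : ℕ} (hn : 2 ≤ n) (hh : 1 ≤ h) (S : Verifier n)
    (hS : S.IsScheme IsInsertionStream maxMatching (1 / 3) (1 / 3) h v) :
    1 / 24576 * (n : ℝ) ^ 2 ≤ h * v := by
  have h1 := le_mul_of_isScheme (m := (n + 2) / 4) (by omega) hh S hS
  have h2 : (n : ℝ) ≤ 8 * ((n + 2) / 4 : ℕ) := by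
    have : n ≤ 8 * ((n + 2) / 4) := by omega
    exact_mod_cast this
  have h3 : (n : ℝ) ^ 2 ≤ (8 * ((n + 2) / 4 : ℕ)) ^ 2 := pow_le_pow_left₀ (by positivity) h2 2
  rw [mul_pow] at h3
  linarith

end Gadget

end GraphStream

/-! ### Reading blocks of bits -/

namespace GraphStream

section BitReader

variable {A St : Type*} {L : ℕ} (hL : 0 < L) (decode : List Bool → A) (step : St → A → St)

/-- From a machine that reads symbols, a machine that reads the symbols as blocks of `L` bits: the
bits of an incomplete block are kept in a buffer. -/
def readBit (x : St × {l : List Bool // l.length < L}) (b : Bool) :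
    St × {l : List Bool // l.length < L} :=
  if h : (x.2.1 ++ [b]).length < L then (x.1, ⟨x.2.1 ++ [b], h⟩)
  else (step x.1 (decode (x.2.1 ++ [b])), ⟨[], hL⟩)

lemma foldl_readBit_block (st : St) (l : List Bool) (hl : l ≠ []) (buf : List Bool)
    (hbuf : buf.length < L) (h : buf.length + l.length = L) :
    l.foldl (readBit hL decode step) (st, ⟨buf, hbuf⟩) = (step st (decode (buf ++ l)), ⟨[], hL⟩) := by
  induction l generalizing buf with
  | nil => exact absurd rfl hl
  | cons b l ih =>
    rw [List.foldl_cons, readBit]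
    simp only [List.length_append, List.length_cons, List.length_nil] at h ⊢
    by_cases hl' : l = []
    · subst hl'
      rw [dif_neg (by simp at h; omega)]
      rfl
    · have hpos := List.length_pos_iff.2 hl'
      rw [dif_pos (by omega), ih hl' (buf ++ [b]) (by simp; omega) (by simp; omega)]
      simp

lemma foldl_readBit_flatMap (encode : A → List Bool)
    (hlen : ∀ x, (encode x).length = L) (henc : ∀ x, decode (encode x) = x) (st : St) (w : List A) :
    (w.flatMap encode).foldl (readBit hL decode step) (st, ⟨[], hL⟩)
      = (w.foldl step st, ⟨[], hL⟩) := by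
  induction w generalizing st with
  | nil => rfl
  | cons x w ih =>
    rw [List.flatMap_cons, List.foldl_append, foldl_readBit_block hL decode step st (encode x) ?_ []
      hL (by simp [hlen]), List.nil_append, henc, ih, List.foldl_cons]
    intro h
    have := hlen x
    rw [h] at this
    simp at this
    omega

/-- Whatever bits are read, the state is that of the symbol machine on some word. The word depends
only on the bits, not on the transition function. -/
lemma exists_word_foldl_readBit (help : List Bool) : ∃ (w : List A)
    (buf : {l : List Bool // l.length < L}), ∀ (step : St → A → St) (st : St),
      help.foldl (readBit hL decode step) (st, ⟨[], hL⟩) = (w.foldl step st, buf) := by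
  induction help using List.reverseRecOn with
  | nil => exact ⟨[], ⟨[], hL⟩, fun _ _ => rfl⟩
  | append_singleton help b ih =>
    obtain ⟨w, buf, h⟩ := ih
    by_cases hb : (buf.1 ++ [b]).length < L
    · refine ⟨w, ⟨buf.1 ++ [b], hb⟩, fun step st => ?_⟩
      rw [List.foldl_append, h, List.foldl_cons, List.foldl_nil, readBit, dif_pos hb]
    · refine ⟨w ++ [decode (buf.1 ++ [b])], ⟨[], hL⟩, fun step st => ?_⟩
      rw [List.foldl_append, h, List.foldl_cons, List.foldl_nil, readBit, dif_neg hb,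
        List.foldl_append, List.foldl_cons, List.foldl_nil]

end BitReader

/-! ### The data of the scheme -/

/-- The part of the proof string that concerns one vertex `u`: its label in the certificate, its
partner in the matching (`u` itself if `u` is unmatched), and the multiplicity of the edge
joining them. -/
abbrev VertexData (n B : ℕ) := Option (Fin n) × Fin n × Fin (B + 1)

/-- The parameters of the scheme. The proof string consists of `2 n t` symbols, each of which is
a triple of elements of the field with `p` elements, encoded by `L` bits. -/
structure SchemeParams (n : ℕ) where
  t : ℕ
  s : ℕ
  B : ℕ
  p : ℕ
  L : ℕ
  n_pos : 0 < n
  t_pos : 0 < t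
  L_pos : 0 < L
  prime : Fact p.Prime
  lt_p : s * (B ^ 2 + 1) < p
  n_lt_p : n < p
  len_le_p : 9 * (2 * n * t) ≤ p
  /-- a covering of the vertices by `t` chunks of size `s` -/
  chunk : ℕ → Fin s → Fin n
  chunk_surj : ∀ w, ∃ a < t, ∃ b, chunk a b = w
  decode : ZMod p → VertexData n B
  encode : VertexData n B → ZMod p
  decode_encode : ∀ x, decode (encode x) = x
  bitDecode : List Bool → ZMod p × ZMod p × ZMod p
  bitEncode : ZMod p × ZMod p × ZMod p → List Bool
  length_bitEncode : ∀ x, (bitEncode x).length = L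
  bitDecode_bitEncode : ∀ x, bitDecode (bitEncode x) = x

namespace SchemeParams

variable {n : ℕ} (P : SchemeParams n)

/-- The field over which the verifier computes. -/
abbrev F := ZMod P.p

instance : Fact P.p.Prime := P.prime

/-- The number of symbols of the proof string. -/
def len : ℕ := 2 * n * P.t

/-- The proof string runs through the vertices again and again; this is the vertex of the symbol
number `i`. -/
def vertex (i : ℕ) : Fin n := ⟨i % n, Nat.mod_lt _ P.n_pos⟩

/-- The chunk treated while symbol number `i` is read. Each chunk is treated during two rounds
through the vertices. -/
def other (i : ℕ) (b : Fin P.s) : Fin n := P.chunk (i / (2 * n)) b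

/-- In the first of the two rounds for a chunk, the data of its vertices are stored. -/
def buffer (c : ℕ → P.F) : ℕ → Fin P.s → P.F
  | 0, _ => 0
  | i + 1, b => if i = 2 * n * (i / (2 * n)) + P.other i b then c i else buffer c i b

lemma buffer_eq (c : ℕ → P.F) (i : ℕ) (b : Fin P.s)
    (h : 2 * n * (i / (2 * n)) + P.other i b < i) :
    P.buffer c i b = c (2 * n * (i / (2 * n)) + P.other i b) := by
  induction i with
  | zero => omega
  | succ i ih =>
    have hn := P.n_pos
    have h1 : 2 * n * ((i + 1) / (2 * n)) ≤ i := by omega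
    have h2 : (i + 1) / (2 * n) = i / (2 * n) := by
      apply le_antisymm
      · rw [Nat.le_div_iff_mul_le (by omega), mul_comm]; exact h1
      · exact Nat.div_le_div_right (by omega)
    have h3 : P.other (i + 1) b = P.other i b := by rw [other, other, h2]
    rw [h2, h3] at h ⊢
    rw [buffer]
    split_ifs with hi
    · rw [← hi]
    · exact ih (by omega)

/-- The registers of the verifier: for each `b` the sketches of the graph, of the selected pairs
and of the claimed multiplicities (numbers 0, 1, 2), and the sketch of the violations of the
certificate, the consistency check, the value of the quotient and the number of matched vertices
(numbers 0 to 3). -/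
abbrev Registers := (Fin 3 × Fin P.s ⊕ Fin 4) → P.F

/-- The memory of the symbol machine: the position in the word (up to `len + 1`), the stored data
of a chunk, and the registers. -/
abbrev State := Fin (P.len + 2) × (Fin P.s → P.F) × P.Registers

/-- Reading a symbol, where `inc i x y` is what symbol `x` at position `i` adds to the registers if
`y` is stored. -/
def step (inc : ℕ → P.F × P.F × P.F → (Fin P.s → P.F) → P.Registers) (m : P.State)
    (x : P.F × P.F × P.F) : P.State :=
  (if h : m.1.val < P.len + 1 then ⟨m.1 + 1, by omega⟩ else m.1,
   fun b => if m.1.val = 2 * n * (m.1.val / (2 * n)) + P.other m.1 b then x.1 else m.2.1 b,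
   m.2.2 + inc m.1 x m.2.1)

lemma foldl_step_position (inc) (acc : P.Registers) (w : List (P.F × P.F × P.F)) :
    (w.foldl (P.step inc) (0, 0, acc)).1.val = min w.length (P.len + 1) := by
  induction w using List.reverseRecOn with
  | nil => simp
  | append_singleton w x ih =>
    rw [List.foldl_append, List.foldl_cons, List.foldl_nil, step]
    simp only [List.length_append, List.length_cons, List.length_nil]
    split_ifs with h
    · simp only [ih] at h ⊢; omega
    · rw [ih] at h ⊢; omega

lemma foldl_step_map_range (inc) (acc : P.Registers) (c : ℕ → P.F × P.F × P.F) (k : ℕ)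
    (hk : k ≤ P.len) :
    (((List.range k).map c).foldl (P.step inc) (0, 0, acc)).2
      = (P.buffer (fun i => (c i).1) k,
        acc + ∑ i ∈ Finset.range k, inc i (c i) (P.buffer (fun i => (c i).1) i)) := by
  induction k with
  | zero => simp only [List.range_zero, List.map_nil, List.foldl_nil, Finset.range_zero,
      Finset.sum_empty, add_zero]; rfl
  | succ k ih =>
    have hpos := P.foldl_step_position inc acc ((List.range k).map c)
    rw [List.length_map, List.length_range, min_eq_left (by omega)] at hpos
    rw [List.range_succ, List.map_append, List.foldl_append, List.map_cons, List.map_nil,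
      List.foldl_cons, List.foldl_nil, step]
    simp only [hpos, ih (by omega)]
    rw [Finset.sum_range_succ, add_assoc]
    rfl

end SchemeParams

end GraphStream

/-! ### The conditions of the certificate as polynomial identities -/

namespace GraphStream

namespace VertexData

variable {n B : ℕ}

/-- The data `x` of `u` say that `u` is matched with `w`. -/
def Claims (u w : Fin n) (x : VertexData n B) : Prop := x.2.1 = w ∧ w ≠ u

/-- The vertices with data `x` and `y` are in different classes of the certificate. -/
def Cross (x y : VertexData n B) : Prop := x.1 ≠ none ∧ y.1 ≠ none ∧ x.1 ≠ y.1

/-- The conditions of the certificate on the data `x` of `u` and `y` of `w` that do not refer to the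
graph. -/
def Ok (u w : Fin n) (x y : VertexData n B) : Prop :=
  x.2.1 = w → y.2.1 = u ∧ (w = u → x.1 = some u) ∧
    (w ≠ u → x.2.2 ≠ 0 ∧ (x.1 = none → y.1 = some w) ∧ ¬ Cross x y)

end VertexData

namespace SchemeParams

open Polynomial VertexData

variable {n : ℕ} (P : SchemeParams n)

/-- In the second of the two rounds for a chunk, all pairs of a vertex and a member of the chunk
are examined. -/
def IsUse (_P : SchemeParams n) (i : ℕ) : Prop := n ≤ i % (2 * n)

open Classical in
/-- The indicator of the pairs for which the multiplicity is prescribed: those claimed to be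
matched, and those in different classes. -/
noncomputable def chi (i : ℕ) (x : P.F) (y : Fin P.s → P.F) (b : Fin P.s) : ℕ :=
  if P.IsUse i ∧ (Claims (P.vertex i) (P.other i b) (P.decode x) ∨
    Cross (P.decode x) (P.decode (y b))) then 1 else 0

open Classical in
/-- The prescribed multiplicity. -/
noncomputable def target (i : ℕ) (x : P.F) (b : Fin P.s) : ℕ :=
  if P.IsUse i ∧ Claims (P.vertex i) (P.other i b) (P.decode x) then (P.decode x).2.2 else 0

open Classical in
/-- The number of pairs that violate the certificate. -/
noncomputable def violations (i : ℕ) (x : P.F) (y : Fin P.s → P.F) : ℕ :=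
  ∑ b, if P.IsUse i ∧ ¬ Ok (P.vertex i) (P.other i b) (P.decode x) (P.decode (y b)) then 1 else 0

/-- The polynomial with value `f i` at the node `i`, for `i < len`. -/
noncomputable def interp (f : ℕ → ℤ) : P.F[X] :=
  Lagrange.interpolate (Finset.range P.len) (fun i : ℕ => (i : P.F)) fun i => (f i : P.F)

/-- The value of the Lagrange basis polynomial of node `i` at `r`. -/
noncomputable def basisAt (r : P.F) (i : ℕ) : P.F :=
  (Lagrange.basis (Finset.range P.len) (fun i : ℕ => (i : P.F)) i).eval r

/-- The polynomial vanishing at all nodes. -/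
noncomputable def nodal : P.F[X] := Lagrange.nodal (Finset.range P.len) fun i : ℕ => (i : P.F)

lemma len_pos : 0 < P.len := Nat.mul_pos (Nat.mul_pos two_pos P.n_pos) P.t_pos

lemma injOn_node : Set.InjOn (fun i : ℕ => (i : P.F)) (Finset.range P.len) := by
  intro i hi j hj h
  have hp := P.len_le_p
  simp only [Finset.coe_range, Set.mem_Iio, len] at hi hj
  have h1 := (ZMod.natCast_eq_natCast_iff' i j P.p).1 h
  rwa [Nat.mod_eq_of_lt (by omega), Nat.mod_eq_of_lt (by omega)] at h1

lemma eval_interp (f : ℕ → ℤ) (r : P.F) :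
    (P.interp f).eval r = ∑ i ∈ Finset.range P.len, f i * P.basisAt r i := by
  simp [interp, Lagrange.interpolate_apply, eval_finsetSum, basisAt]

lemma eval_interp_node (f : ℕ → ℤ) {i : ℕ} (hi : i < P.len) :
    (P.interp f).eval (i : P.F) = f i :=
  Lagrange.eval_interpolate_at_node _ P.injOn_node (Finset.mem_range.2 hi)

lemma natDegree_interp_lt (f : ℕ → ℤ) : (P.interp f).natDegree < P.len := by
  have h := Lagrange.degree_interpolate_lt (fun i => (f i : P.F)) P.injOn_node
  rw [Finset.card_range] at h
  have hpos := P.len_pos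
  by_cases h0 : P.interp f = 0
  · rwa [h0, natDegree_zero]
  · exact (natDegree_lt_iff_degree_lt h0).2 h

/-- The deviation at position `i` from the prescribed multiplicities, plus the number of violations
of the certificate. It vanishes only if all is correct. -/
noncomputable def residual (A : ℕ → Fin P.s → ℤ) (c : ℕ → P.F) (i : ℕ) : ℤ :=
  ∑ b, P.chi i (c i) (P.buffer c i) b * (A i b - P.target i (c i) b) ^ 2
    + P.violations i (c i) (P.buffer c i)

/-- A polynomial of low degree whose value at node `i` is the residual at position `i`. -/
noncomputable def residualPoly (A : ℕ → Fin P.s → ℤ) (c : ℕ → P.F) : P.F[X] :=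
  ∑ b, P.interp (fun i => P.chi i (c i) (P.buffer c i) b)
      * (P.interp (fun i => A i b) - P.interp fun i => P.target i (c i) b) ^ 2
    + P.interp fun i => P.violations i (c i) (P.buffer c i)

lemma eval_residualPoly_node (A : ℕ → Fin P.s → ℤ) (c : ℕ → P.F) {i : ℕ} (hi : i < P.len) :
    (P.residualPoly A c).eval (i : P.F) = P.residual A c i := by
  simp [residualPoly, residual, eval_finsetSum, P.eval_interp_node _ hi]

lemma natDegree_mul_sub_sq_le {R : Type*} [Ring R] {f g h : R[X]} {d : ℕ} (hf : f.natDegree ≤ d)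
    (hg : g.natDegree ≤ d) (hh : h.natDegree ≤ d) : (f * (g - h) ^ 2).natDegree ≤ 3 * d := by
  have h1 : (g - h).natDegree ≤ d := (natDegree_sub_le g h).trans (max_le hg hh)
  have h2 := natDegree_pow_le_of_le 2 h1
  exact (natDegree_mul_le_of_le hf h2).trans (by omega)

lemma natDegree_residualPoly_le (A : ℕ → Fin P.s → ℤ) (c : ℕ → P.F) :
    (P.residualPoly A c).natDegree + 3 ≤ 3 * P.len := by
  have hpos := P.len_pos
  have h : (P.residualPoly A c).natDegree ≤ 3 * (P.len - 1) := by
    refine natDegree_add_le_of_degree_le (natDegree_sum_le_of_forall_le _ _ fun b _ => ?_) ?_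
    · exact natDegree_mul_sub_sq_le (Nat.le_sub_one_of_lt (P.natDegree_interp_lt _))
        (Nat.le_sub_one_of_lt (P.natDegree_interp_lt _))
        (Nat.le_sub_one_of_lt (P.natDegree_interp_lt _))
    · have := P.natDegree_interp_lt fun i => P.violations i (c i) (P.buffer c i)
      omega
  omega

/-- The residuals are small enough to be recovered from their classes modulo `p`. -/
lemma residual_eq_zero_of_cast {A : ℕ → Fin P.s → ℤ} (hA : ∀ i b, 0 ≤ A i b ∧ A i b ≤ P.B)
    {c : ℕ → P.F} {i : ℕ} (h : (P.residual A c i : P.F) = 0) : P.residual A c i = 0 := by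
  have h0 : 0 ≤ P.residual A c i :=
    add_nonneg (Finset.sum_nonneg fun b _ => mul_nonneg (by positivity) (sq_nonneg _))
      (by positivity)
  have h1 : ∀ b, P.chi i (c i) (P.buffer c i) b * (A i b - P.target i (c i) b) ^ 2
      ≤ (P.B : ℤ) ^ 2 := by
    intro b
    obtain ⟨h2, h3⟩ := hA i b
    have h4 : P.target i (c i) b ≤ P.B := by
      unfold target
      split_ifs
      · exact Nat.lt_succ_iff.1 (P.decode (c i)).2.2.2
      · exact Nat.zero_le _
    have h5 : (A i b - P.target i (c i) b) ^ 2 ≤ (P.B : ℤ) ^ 2 := by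
      rw [sq_le_sq, abs_of_nonneg (by positivity : (0 : ℤ) ≤ P.B), abs_le]
      constructor <;> omega
    unfold chi
    split_ifs
    · simpa using h5
    · simp only [Nat.cast_zero, zero_mul]; positivity
  have h2 : P.violations i (c i) (P.buffer c i) ≤ P.s := by
    refine (Finset.sum_le_sum fun b _ => (?_ : _ ≤ 1)).trans (by simp)
    split_ifs <;> simp
  have h3 : P.residual A c i < P.p := by
    have h4 := Finset.sum_le_sum fun b (_ : b ∈ Finset.univ) => h1 b
    rw [Finset.sum_const, Finset.card_univ, Fintype.card_fin, nsmul_eq_mul] at h4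
    have h5 : (P.s : ℤ) * (P.B ^ 2 + 1) < P.p := by exact_mod_cast P.lt_p
    rw [residual]
    have h6 : (P.violations i (c i) (P.buffer c i) : ℤ) ≤ P.s := by exact_mod_cast h2
    linarith
  exact Int.eq_zero_of_dvd_of_nonneg_of_lt h0 h3 ((ZMod.intCast_zmod_eq_zero_iff_dvd _ _).1 h)

/-- The residual vanishes if and only if each pair treated at position `i` satisfies the
certificate and has the prescribed multiplicity. -/
lemma residual_eq_zero_iff {A : ℕ → Fin P.s → ℤ} {c : ℕ → P.F} {i : ℕ} (hi : P.IsUse i) :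
    P.residual A c i = 0 ↔ ∀ b,
      Ok (P.vertex i) (P.other i b) (P.decode (c i)) (P.decode (P.buffer c i b)) ∧
      (Claims (P.vertex i) (P.other i b) (P.decode (c i)) → A i b = (P.decode (c i)).2.2) ∧
      (Cross (P.decode (c i)) (P.decode (P.buffer c i b)) → A i b = 0) := by
  classical
  have hnn : ∀ b, 0 ≤ (P.chi i (c i) (P.buffer c i) b : ℤ) * (A i b - P.target i (c i) b) ^ 2 :=
    fun b => mul_nonneg (by positivity) (sq_nonneg _)
  rw [residual, add_eq_zero_iff_of_nonneg (Finset.sum_nonneg fun b _ => hnn b) (by positivity),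
    Finset.sum_eq_zero_iff_of_nonneg fun b _ => hnn b, Nat.cast_eq_zero, violations,
    Finset.sum_eq_zero_iff]
  simp only [Finset.mem_univ, true_implies, ← forall_and]
  refine forall_congr' fun b => ?_
  have hex : Ok (P.vertex i) (P.other i b) (P.decode (c i)) (P.decode (P.buffer c i b)) →
      Claims (P.vertex i) (P.other i b) (P.decode (c i)) →
      ¬ Cross (P.decode (c i)) (P.decode (P.buffer c i b)) := fun h1 h2 => ((h1 h2.1).2.2 h2.2).2.2
  unfold chi target
  simp only [hi, true_and]
  by_cases h1 : Ok (P.vertex i) (P.other i b) (P.decode (c i)) (P.decode (P.buffer c i b)) <;>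
  by_cases h2 : Claims (P.vertex i) (P.other i b) (P.decode (c i)) <;>
  by_cases h3 : Cross (P.decode (c i)) (P.decode (P.buffer c i b)) <;>
  simp_all [sub_eq_zero]

lemma residual_eq_zero_of_not_isUse {A : ℕ → Fin P.s → ℤ} {c : ℕ → P.F} {i : ℕ}
    (hi : ¬ P.IsUse i) : P.residual A c i = 0 := by
  simp [residual, chi, violations, hi]

/-- What the symbol `x` at position `i` contributes to the consistency check at the point `r`. -/
def consTerm {R : Type*} [Ring R] (i : ℕ) (x r : R) : R :=
  x * ((if i + n < P.len then r ^ i else 0) - if n ≤ i then r ^ (i - n) else 0)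

/-- The polynomial with coefficients `c i - c (i + n)`. -/
noncomputable def consPoly (c : ℕ → P.F) : P.F[X] :=
  ∑ i ∈ Finset.range P.len, P.consTerm i (C (c i)) X

lemma eval_consPoly (c : ℕ → P.F) (r : P.F) :
    (P.consPoly c).eval r = ∑ i ∈ Finset.range P.len, P.consTerm i (c i) r := by
  rw [consPoly, eval_finsetSum]
  refine Finset.sum_congr rfl fun i _ => ?_
  simp only [consTerm]
  split_ifs <;> simp

lemma coeff_consPoly (c : ℕ → P.F) (j : ℕ) :
    (P.consPoly c).coeff j = if j + n < P.len then c j - c (j + n) else 0 := by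
  have h : ∀ i ∈ Finset.range P.len, (P.consTerm i (C (c i)) (X : P.F[X])).coeff j
      = (if j = i then if j + n < P.len then c j else 0 else 0)
        - if j + n = i then c (j + n) else 0 := by
    intro i hi
    rw [consTerm, coeff_C_mul, coeff_sub, mul_sub]
    congr 1
    · by_cases h : j = i
      · subst h; rw [if_pos rfl]; split_ifs <;> simp
      · rw [if_neg h]; split_ifs <;> simp [coeff_X_pow, h]
    · by_cases h : j + n = i
      · subst h; simp [coeff_X_pow]
      · rw [if_neg h]
        split_ifs with hn
        · rw [coeff_X_pow, if_neg (by omega), mul_zero]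
        · simp
  rw [consPoly, finsetSum_coeff, Finset.sum_congr rfl h, Finset.sum_sub_distrib,
    Finset.sum_ite_eq, Finset.sum_ite_eq]
  simp only [Finset.mem_range]
  split_ifs <;> first | omega | simp

lemma natDegree_consPoly_le (c : ℕ → P.F) : (P.consPoly c).natDegree ≤ P.len := by
  rw [natDegree_le_iff_coeff_eq_zero]
  intro j hj
  rw [coeff_consPoly, if_neg (by omega)]

lemma eq_vertex_of_consPoly_eq_zero {c : ℕ → P.F} (h : P.consPoly c = 0) (i : ℕ)
    (hi : i < P.len) : c i = c (P.vertex i) := by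
  have hn := P.n_pos
  induction i using Nat.strong_induction_on with
  | _ i ih =>
  by_cases hin : i < n
  · simp [vertex, Nat.mod_eq_of_lt hin]
  · have h1 := P.coeff_consPoly c (i - n)
    rw [h, coeff_zero, if_pos (by omega), Nat.sub_add_cancel (by omega)] at h1
    rw [← sub_eq_zero.1 h1.symm, ih (i - n) (by omega) (by omega)]
    congr 1
    simp only [vertex]
    rw [Nat.mod_eq_sub_mod (by omega : i ≥ n)]

/-- The quotient of the residual polynomial by `nodal`, as sent by the prover: each symbol holds one
coefficient of the lower and one of the upper half. -/
noncomputable def quotPoly (q q' : ℕ → P.F) : P.F[X] :=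
  ∑ i ∈ Finset.range P.len, (C (q i) * X ^ i + C (q' i) * X ^ (P.len + i))

lemma natDegree_quotPoly_le (q q' : ℕ → P.F) : (P.quotPoly q q').natDegree ≤ 2 * P.len := by
  refine natDegree_sum_le_of_forall_le _ _ fun i hi => ?_
  have := Finset.mem_range.1 hi
  exact natDegree_add_le_of_degree_le ((natDegree_C_mul_X_pow_le _ _).trans (by omega))
    ((natDegree_C_mul_X_pow_le _ _).trans (by omega))

lemma eq_quotPoly {Q : P.F[X]} (hQ : Q.natDegree < 2 * P.len) :
    Q = P.quotPoly (fun i => Q.coeff i) fun i => Q.coeff (P.len + i) := by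
  conv_lhs => rw [Q.as_sum_range_C_mul_X_pow' hQ, two_mul, Finset.sum_range_add]
  rw [quotPoly, Finset.sum_add_distrib]

lemma nodal_monic : P.nodal.Monic := Lagrange.nodal_monic

lemma natDegree_nodal : P.nodal.natDegree = P.len := by
  rw [nodal, Lagrange.natDegree_nodal, Finset.card_range]

/-- A polynomial that vanishes at all nodes is a multiple of `nodal`. -/
lemma nodal_mul_divByMonic {R : P.F[X]} (h : ∀ i < P.len, R.eval (i : P.F) = 0) :
    P.nodal * (R /ₘ P.nodal) = R := by
  have h1 : R %ₘ P.nodal = 0 := by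
    refine eq_zero_of_degree_lt_of_eval_index_eq_zero _ P.injOn_node ?_ fun i hi => ?_
    · have := degree_modByMonic_lt R P.nodal_monic
      rwa [nodal, Lagrange.degree_nodal] at this
    · have h2 := congrArg (eval (i : P.F)) (modByMonic_add_div R P.nodal)
      have h3 : P.nodal.eval (i : P.F) = 0 := Lagrange.eval_nodal_at_node hi
      rwa [eval_add, eval_mul, h3, zero_mul, add_zero, h i (Finset.mem_range.1 hi)] at h2
  have := modByMonic_add_div R P.nodal
  rwa [h1, zero_add] at this

end SchemeParams

end GraphStream

/-! ### The verifier -/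

namespace GraphStream

namespace SchemeParams

open Polynomial VertexData SimpleGraph

variable {n : ℕ} (P : SchemeParams n)

/-- The multiplicities of the pairs treated at each position. -/
def mults (σ : List (EdgeUpdate n)) (i : ℕ) (b : Fin P.s) : ℤ :=
  edgeMult σ s(P.vertex i, P.other i b)

/-- What a token adds to the registers, that is, to the sketch of the graph at the point `r`. -/
noncomputable def tokenInc (r : P.F) (a : EdgeUpdate n) : P.Registers :=
  Sum.elim (fun k => if k.1 = 0 then
    ∑ i ∈ Finset.range P.len, (if s(a.u, a.v) = s(P.vertex i, P.other i k.2) then (a.Δ : P.F) else 0)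
      * P.basisAt r i else 0) 0

open Classical in
/-- What a symbol adds to the registers. -/
noncomputable def symbolInc (r : P.F) (i : ℕ) (x : P.F × P.F × P.F) (y : Fin P.s → P.F) :
    P.Registers :=
  Sum.elim
    (fun k => ![0, (P.chi i x.1 y k.2 : P.F), (P.target i x.1 k.2 : P.F)] k.1 * P.basisAt r i)
    ![(P.violations i x.1 y : P.F) * P.basisAt r i, P.consTerm i x.1 r,
      x.2.1 * r ^ i + x.2.2 * r ^ (P.len + i),
      if i < n ∧ (P.decode x.1).2.1 ≠ P.vertex i then 1 else 0]

/-- The verifier accepts if the consistency check succeeds and the identity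
`residualPoly = nodal * quotPoly` holds at `r`. -/
def Accepts (r : P.F) (z : P.Registers) : Prop :=
  z (Sum.inr 1) = 0 ∧
    ∑ b, z (Sum.inl (1, b)) * (z (Sum.inl (0, b)) - z (Sum.inl (2, b))) ^ 2 + z (Sum.inr 0)
      = P.nodal.eval r * z (Sum.inr 2)

/-- The memory of the verifier. -/
abbrev Memory := P.State × {l : List Bool // l.length < P.L}

/-- The memory after the token `a`. -/
noncomputable def readToken (r : P.F) (m : P.Memory) (a : EdgeUpdate n) : P.Memory :=
  ((m.1.1, m.1.2.1, m.1.2.2 + P.tokenInc r a), m.2)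

open Classical in
/-- The answer of the verifier. The number of edges of the matching is half the number of matched
vertices. -/
noncomputable def answer (r : P.F) (m : P.Memory) : Option ℕ :=
  if m.1.1.val = P.len ∧ P.Accepts r m.1.2.2 then some ((m.1.2.2 (Sum.inr 3)).val / 2) else none

/-- The verifier of the scheme, whose coins determine the evaluation point `r`. -/
noncomputable def verifier : Verifier n where
  Coins := P.F
  Mem := P.Memory
  coins_finite := inferInstance
  coins_nonempty := inferInstance
  mem_finite := inferInstance
  start _ := ((0, 0, 0), ⟨[], P.L_pos⟩)
  readToken := P.readToken
  readHelp r := readBit P.L_pos P.bitDecode (P.step (P.symbolInc r))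
  answer := P.answer

/-- The registers after the stream `σ`. -/
noncomputable def sketch (r : P.F) (σ : List (EdgeUpdate n)) : P.Registers :=
  (σ.map (P.tokenInc r)).sum

/-- The output of the verifier on the stream `σ` and the proof string `help`. -/
noncomputable def run (r : P.F) (σ : List (EdgeUpdate n)) (help : List Bool) : Option ℕ :=
  P.answer r (help.foldl (readBit P.L_pos P.bitDecode (P.step (P.symbolInc r)))
    ((0, 0, P.sketch r σ), ⟨[], P.L_pos⟩))

lemma foldl_readToken (r : P.F) (σ : List (EdgeUpdate n)) (acc : P.Registers) :
    σ.foldl (P.readToken r) ((0, 0, acc), ⟨[], P.L_pos⟩)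
      = ((0, 0, acc + P.sketch r σ), ⟨[], P.L_pos⟩) := by
  induction σ generalizing acc with
  | nil => simp [sketch]
  | cons a σ ih =>
    rw [List.foldl_cons, readToken, ih]
    simp only [sketch, List.map_cons, List.sum_cons, add_assoc]

lemma out_verifier (r : P.F) (σ : List (EdgeUpdate n)) (help : List Bool) :
    P.verifier.out r (P.verifier.summary r σ) help = P.run r σ help := by
  have h := P.foldl_readToken r σ 0
  rw [zero_add] at h
  rw [run, ← h]
  rfl

lemma sketch_inl_zero (r : P.F) (σ : List (EdgeUpdate n)) (b : Fin P.s) :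
    P.sketch r σ (Sum.inl (0, b)) = (P.interp fun i => P.mults σ i b).eval r := by
  rw [eval_interp]
  induction σ with
  | nil => simp [sketch, mults, edgeMult]
  | cons a σ ih =>
    have h : P.sketch r (a :: σ) = P.tokenInc r a + P.sketch r σ := by
      simp [sketch]
    rw [h, Pi.add_apply, ih, tokenInc, Sum.elim_inl, if_pos rfl, ← Finset.sum_add_distrib]
    refine Finset.sum_congr rfl fun i _ => ?_
    rw [mults, mults, edgeMult_cons, Int.cast_add, add_mul]
    congr 2
    split_ifs <;> simp

lemma sketch_eq_zero (r : P.F) (σ : List (EdgeUpdate n)) {k : Fin 3 × Fin P.s ⊕ Fin 4}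
    (hk : ∀ b, k ≠ Sum.inl (0, b)) : P.sketch r σ k = 0 := by
  induction σ with
  | nil => simp [sketch]
  | cons a σ ih =>
    have h : P.sketch r (a :: σ) = P.tokenInc r a + P.sketch r σ := by
      simp [sketch]
    rw [h, Pi.add_apply, ih, add_zero, tokenInc]
    rcases k with ⟨k, b⟩ | k
    · rw [Sum.elim_inl, if_neg]
      rintro rfl
      exact hk b rfl
    · rfl

/-- The registers after the stream `σ` and the word `w`. -/
noncomputable def finalRegisters (r : P.F) (σ : List (EdgeUpdate n)) (w : ℕ → P.F × P.F × P.F) :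
    P.Registers :=
  P.sketch r σ + ∑ i ∈ Finset.range P.len,
    P.symbolInc r i (w i) (P.buffer (fun i => (w i).1) i)

/-- The number of matched vertices according to the proof string. -/
noncomputable def numMatched (c : ℕ → P.F) : ℕ :=
  (Finset.univ.filter fun u : Fin n => (P.decode (c u)).2.1 ≠ u).card

lemma finalRegisters_count (r : P.F) (σ : List (EdgeUpdate n)) (w : ℕ → P.F × P.F × P.F) :
    P.finalRegisters r σ w (Sum.inr 3) = P.numMatched fun i => (w i).1 := by
  classical
  have hn := P.n_pos
  have hle : n ≤ P.len := by
    have := P.t_pos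
    unfold len
    nlinarith
  rw [finalRegisters, Pi.add_apply, P.sketch_eq_zero r σ (by simp), zero_add, Finset.sum_apply,
    numMatched, Finset.card_filter, Nat.cast_sum, Finset.sum_fin_eq_sum_range,
    ← Finset.sum_subset (Finset.range_mono hle)]
  · refine Finset.sum_congr rfl fun i hi => ?_
    have hi' := Finset.mem_range.1 hi
    have hv : P.vertex i = ⟨i, hi'⟩ := Fin.ext (Nat.mod_eq_of_lt hi')
    simp [symbolInc, hi', hv]
  · intro i _ hi
    simp only [Finset.mem_range] at hi
    simp [symbolInc, hi]

lemma val_finalRegisters_count (r : P.F) (σ : List (EdgeUpdate n)) (w : ℕ → P.F × P.F × P.F) :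
    (P.finalRegisters r σ w (Sum.inr 3)).val = P.numMatched fun i => (w i).1 := by
  rw [finalRegisters_count, ZMod.val_natCast, Nat.mod_eq_of_lt]
  refine lt_of_le_of_lt ((Finset.card_le_univ _).trans ?_) P.n_lt_p
  simp

lemma accepts_finalRegisters (r : P.F) (σ : List (EdgeUpdate n)) (w : ℕ → P.F × P.F × P.F) :
    P.Accepts r (P.finalRegisters r σ w) ↔
      (P.consPoly fun i => (w i).1).eval r = 0 ∧
      (P.residualPoly (P.mults σ) fun i => (w i).1).eval r
        = (P.nodal * P.quotPoly (fun i => (w i).2.1) fun i => (w i).2.2).eval r := by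
  have h0 : ∀ b, P.finalRegisters r σ w (Sum.inl (0, b))
      = (P.interp fun i => P.mults σ i b).eval r := by
    intro b
    rw [finalRegisters, Pi.add_apply, sketch_inl_zero, Finset.sum_apply, Finset.sum_eq_zero,
      add_zero]
    intro i _
    simp [symbolInc]
  have h1 : ∀ b, P.finalRegisters r σ w (Sum.inl (1, b)) = (P.interp fun i =>
      P.chi i (w i).1 (P.buffer (fun i => (w i).1) i) b).eval r := by
    intro b
    rw [finalRegisters, Pi.add_apply, P.sketch_eq_zero r σ (by simp), zero_add, Finset.sum_apply,
      eval_interp]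
    simp [symbolInc]
  have h2 : ∀ b, P.finalRegisters r σ w (Sum.inl (2, b)) = (P.interp fun i =>
      P.target i (w i).1 b).eval r := by
    intro b
    rw [finalRegisters, Pi.add_apply, P.sketch_eq_zero r σ (by simp), zero_add, Finset.sum_apply,
      eval_interp]
    simp [symbolInc]
  have h3 : P.finalRegisters r σ w (Sum.inr 0) = (P.interp fun i =>
      P.violations i (w i).1 (P.buffer (fun i => (w i).1) i)).eval r := by
    rw [finalRegisters, Pi.add_apply, P.sketch_eq_zero r σ (by simp), zero_add, Finset.sum_apply,
      eval_interp]
    simp [symbolInc]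
  have h4 : P.finalRegisters r σ w (Sum.inr 1) = (P.consPoly fun i => (w i).1).eval r := by
    rw [finalRegisters, Pi.add_apply, P.sketch_eq_zero r σ (by simp), zero_add, Finset.sum_apply,
      eval_consPoly]
    simp [symbolInc]
  have h5 : P.finalRegisters r σ w (Sum.inr 2)
      = (P.quotPoly (fun i => (w i).2.1) fun i => (w i).2.2).eval r := by
    rw [finalRegisters, Pi.add_apply, P.sketch_eq_zero r σ (by simp), zero_add, Finset.sum_apply,
      quotPoly, eval_finsetSum]
    simp [symbolInc]
  simp only [Accepts, h0, h1, h2, h3, h4, h5, residualPoly, eval_add, eval_finsetSum, eval_mul,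
    eval_pow, eval_sub]

open Classical in
/-- The answer after the stream `σ` and a word of the right length. -/
lemma answer_foldl_step (r : P.F) (σ : List (EdgeUpdate n)) (w : ℕ → P.F × P.F × P.F)
    (buf : {l : List Bool // l.length < P.L}) :
    P.answer r
      (((List.range P.len).map w).foldl (P.step (P.symbolInc r)) (0, 0, P.sketch r σ), buf)
    = if P.Accepts r (P.finalRegisters r σ w) then
        some ((P.numMatched fun i => (w i).1) / 2) else none := by
  have h1 := P.foldl_step_position (P.symbolInc r) (P.sketch r σ) ((List.range P.len).map w)
  rw [List.length_map, List.length_range, min_eq_left (by omega)] at h1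
  have h2 := P.foldl_step_map_range (P.symbolInc r) (P.sketch r σ) w P.len le_rfl
  simp only [answer, h1, h2, true_and]
  rw [← finalRegisters, val_finalRegisters_count]

/-! ### Soundness and completeness of the scheme -/

/-- If the identities checked by the verifier hold, the proof string contains a certificate. -/
lemma exists_isMatchingCert {σ : List (EdgeUpdate n)} (hσ : IsTurnstileStream P.B σ) {c : ℕ → P.F}
    (hcons : P.consPoly c = 0)
    (hres : ∀ i < P.len, (P.residualPoly (P.mults σ) c).eval (i : P.F) = 0) :
    ∃ l, IsMatchingCert (graphOf σ) (fun u => (P.decode (c u)).2.1) l := by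
  have hn := P.n_pos
  have hpair : ∀ u w : Fin n, Ok u w (P.decode (c u)) (P.decode (c w)) ∧
      (Claims u w (P.decode (c u)) → edgeMult σ s(u, w) = (P.decode (c u)).2.2) ∧
      (Cross (P.decode (c u)) (P.decode (c w)) → edgeMult σ s(u, w) = 0) := by
    intro u w
    obtain ⟨a, ha, b, rfl⟩ := P.chunk_surj w
    obtain ⟨i, hi⟩ : ∃ i, i = 2 * n * a + (n + u) := ⟨_, rfl⟩
    have hu := u.2
    have hdiv : i / (2 * n) = a := by
      rw [hi, Nat.mul_add_div (by omega), Nat.div_eq_of_lt (by omega), add_zero]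
    have hmod : i % (2 * n) = n + u := by
      rw [hi, Nat.mul_add_mod, Nat.mod_eq_of_lt (by omega)]
    have hlen : i < P.len := by
      have : 2 * n * a + 2 * n ≤ 2 * n * P.t := by
        rw [← Nat.mul_succ]; exact Nat.mul_le_mul_left _ ha
      rw [hi, len]
      omega
    have hv : P.vertex i = u := by
      apply Fin.ext
      rw [vertex, hi, show 2 * n * a + (n + u) = u + n * (2 * a + 1) by ring]
      simp [Nat.mod_eq_of_lt hu]
    have hother : P.other i b = P.chunk a b := by rw [other, hdiv]
    have hlt := (P.chunk a b).2
    have hbuf := P.buffer_eq c i b (by rw [hdiv, hother]; omega)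
    rw [hdiv, hother, P.eq_vertex_of_consPoly_eq_zero hcons _ (by omega)] at hbuf
    have hv' : P.vertex (2 * n * a + P.chunk a b) = P.chunk a b := by
      apply Fin.ext
      rw [vertex, show 2 * n * a + (P.chunk a b).val = (P.chunk a b).val + n * (2 * a) by ring]
      simp [Nat.mod_eq_of_lt hlt]
    have hr := hres i hlen
    rw [P.eval_residualPoly_node _ _ hlen] at hr
    have hr' := P.residual_eq_zero_of_cast (fun i b => hσ _) hr
    rw [P.residual_eq_zero_iff (by rw [IsUse, hmod]; omega)] at hr'
    have : _ ∧ (_ → edgeMult σ s(P.vertex i, P.other i b) = _) ∧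
      (_ → edgeMult σ s(P.vertex i, P.other i b) = 0) := hr' b
    rwa [hbuf, hv', P.eq_vertex_of_consPoly_eq_zero hcons i hlen, hv, hother] at this
  refine ⟨fun u => (P.decode (c u)).1, ⟨fun u => ?_, fun u hu => ?_⟩, fun u hu => ?_,
    fun u hu hl => ?_, fun u w z z' hadj hz hz' => ?_⟩
  · exact ((hpair u _).1 rfl).1
  · have h1 := (hpair u _).2.1 ⟨rfl, hu⟩
    have h2 := (((hpair u _).1 rfl).2.2 hu).1
    rw [graphOf_adj, h1]
    have h3 : ((P.decode (c u)).2.2 : ℕ) ≠ 0 := fun h => h2 (Fin.ext h)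
    exact_mod_cast Nat.pos_of_ne_zero h3
  · exact ((hpair u u).1 hu).2.1 rfl
  · exact (((hpair u _).1 rfl).2.2 hu).2.1 hl
  · by_contra hne
    have := (hpair u w).2.2 ⟨by rw [hz]; simp, by rw [hz']; simp, by rw [hz, hz']; simpa using hne⟩
    rw [graphOf_adj, this] at hadj
    exact lt_irrefl _ hadj

lemma half_numMatched_eq {σ : List (EdgeUpdate n)} {c : ℕ → P.F}
    (h : IsMaxMatchingMap (graphOf σ) fun u => (P.decode (c u)).2.1) :
    P.numMatched c / 2 = maxMatching σ := by
  have h1 := two_mul_matchingNumber_add_card_exposed h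
  have h2 := Finset.card_filter_add_card_filter_not (s := (Finset.univ : Finset (Fin n)))
    fun u : Fin n => (P.decode (c u)).2.1 = u
  rw [Finset.card_univ] at h2
  rw [exposed] at h1
  rw [numMatched, maxMatching]
  simp only [ne_eq] at h2 ⊢
  omega

lemma card_eval_eq_zero_le {q : P.F[X]} (hq : q ≠ 0) {d : ℕ} (hd : q.natDegree ≤ d) :
    Nat.card {r : P.F // q.eval r = 0} ≤ d := by
  classical
  rw [Nat.card_eq_fintype_card, Fintype.card_subtype]
  refine le_trans (Finset.card_le_card (t := q.roots.toFinset) fun r hr => ?_)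
    ((Multiset.toFinset_card_le _).trans ((card_roots' q).trans hd))
  simpa [hq] using hr

/-- Only for few points `r` can the verifier be led to a wrong answer. -/
lemma card_wrong_le {σ : List (EdgeUpdate n)} (hσ : IsTurnstileStream P.B σ) (help : List Bool) :
    Nat.card {r : P.F // P.run r σ help ∉
      ({some (maxMatching σ), none} : Set (Option ℕ))} ≤ 3 * P.len := by
  classical
  obtain ⟨w, buf, hw⟩ := exists_word_foldl_readBit (St := P.State) P.L_pos P.bitDecode help
  have hout : ∀ r, P.run r σ help
      = P.answer r (w.foldl (P.step (P.symbolInc r)) (0, 0, P.sketch r σ), buf) := by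
    intro r
    rw [run, hw]
  simp only [hout]
  by_cases hlen : w.length = P.len
  · set v : ℕ → P.F × P.F × P.F := fun i => w.getD i 0 with hv
    have hwv : w = (List.range P.len).map v := by
      refine List.ext_getElem (by simp [hlen]) fun i h1 h2 => ?_
      rw [List.getElem_map, List.getElem_range, hv]
      exact (List.getD_eq_getElem _ _ h1).symm
    rw [hwv]
    simp only [answer_foldl_step, accepts_finalRegisters]
    set c : ℕ → P.F := fun i => (v i).1 with hc
    set D : P.F[X] := P.residualPoly (P.mults σ) c
      - P.nodal * P.quotPoly (fun i => (v i).2.1) fun i => (v i).2.2 with hD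
    by_cases hcons : P.consPoly c = 0
    · by_cases hD0 : D = 0
      · -- both identities hold, so the answer is correct for all `r`
        have hres : P.residualPoly (P.mults σ) c
            = P.nodal * P.quotPoly (fun i => (v i).2.1) fun i => (v i).2.2 := sub_eq_zero.1 hD0
        obtain ⟨l, hl⟩ := P.exists_isMatchingCert hσ hcons fun i hi => by
          rw [hres, eval_mul, nodal, Lagrange.eval_nodal_at_node (Finset.mem_range.2 hi), zero_mul]
        have hval := P.half_numMatched_eq hl.isMaxMatchingMap
        rw [hval]
        refine le_trans (le_of_eq ?_) (Nat.zero_le _)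
        rw [Nat.card_eq_zero]
        left
        refine ⟨fun r => r.2 ?_⟩
        split_ifs <;> simp
      · refine le_trans ?_ (P.card_eval_eq_zero_le hD0 (d := 3 * P.len) ?_)
        · refine Nat.card_le_card_of_injective (fun r => ⟨r.1, ?_⟩) fun r r' h =>
            Subtype.ext (congrArg (fun x => x.1) h)
          by_contra hne
          apply r.2
          rw [if_neg]
          · simp
          · rintro ⟨-, h⟩
            apply hne
            rw [hD, eval_sub, h, sub_self]
        · have h1 := P.natDegree_residualPoly_le (P.mults σ) c
          have h2 := natDegree_mul_le_of_le P.natDegree_nodal.le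
            (P.natDegree_quotPoly_le (fun i => (v i).2.1) fun i => (v i).2.2)
          refine (natDegree_sub_le _ _).trans (max_le (by omega) (h2.trans (by omega)))
    · refine le_trans ?_ (P.card_eval_eq_zero_le hcons (d := 3 * P.len) ?_)
      · refine Nat.card_le_card_of_injective (fun r => ⟨r.1, ?_⟩) fun r r' h =>
          Subtype.ext (congrArg (fun x => x.1) h)
        by_contra hne
        apply r.2
        rw [if_neg]
        · simp
        · rintro ⟨h, -⟩
          exact hne h
      · exact (P.natDegree_consPoly_le c).trans (by omega)
  · -- words of the wrong length are rejected
    refine le_trans (le_of_eq ?_) (Nat.zero_le _)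
    rw [Nat.card_eq_zero]
    left
    refine ⟨fun r => r.2 ?_⟩
    have hpos := P.foldl_step_position (P.symbolInc r.1) (P.sketch r.1 σ) w
    have hne : (w.foldl (P.step (P.symbolInc r.1)) (0, 0, P.sketch r.1 σ)).1.val ≠ P.len := by
      rw [hpos]; omega
    simp [answer, hne]

/-- The honest prover sends a certificate and the quotient of the residual polynomial. -/
lemma exists_help {σ : List (EdgeUpdate n)} (hσ : IsTurnstileStream P.B σ) :
    ∃ help : List Bool, help.length = P.len * P.L ∧
      ∀ r, P.run r σ help = some (maxMatching σ) := by
  classical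
  obtain ⟨f, hf⟩ := exists_isMaxMatchingMap (graphOf σ)
  obtain ⟨l, hl⟩ := hf.exists_cert
  have hB : ∀ u w, (edgeMult σ s(u, w)).toNat < P.B + 1 := fun u w => by
    have := hσ s(u, w)
    omega
  let D : Fin n → VertexData n P.B := fun u => (l u, f u, ⟨(edgeMult σ s(u, f u)).toNat, hB _ _⟩)
  set c : ℕ → P.F := fun i => P.encode (D (P.vertex i)) with hc
  have hdec : ∀ i, P.decode (c i) = D (P.vertex i) := fun i => P.decode_encode _
  have hvert : ∀ u : Fin n, P.vertex u = u := fun u => Fin.ext (Nat.mod_eq_of_lt u.2)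
  have hcons : P.consPoly c = 0 := by
    ext j
    rw [coeff_consPoly, coeff_zero]
    split_ifs
    · rw [sub_eq_zero, hc]
      simp only [vertex, Nat.add_mod_right]
    · rfl
  have hpair : ∀ u w : Fin n, Ok u w (D u) (D w) ∧
      (Claims u w (D u) → edgeMult σ s(u, w) = (D u).2.2) ∧
      (Cross (D u) (D w) → edgeMult σ s(u, w) = 0) := by
    intro u w
    have hcross : ¬ 0 < edgeMult σ s(u, w) ∨ ¬ Cross (D u) (D w) := by
      by_contra! hcon
      obtain ⟨h1, h2, h3, h4⟩ := hcon
      obtain ⟨z, hz⟩ := Option.ne_none_iff_exists'.1 h2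
      obtain ⟨z', hz'⟩ := Option.ne_none_iff_exists'.1 h3
      apply h4
      rw [hz, hz', hl.noCross u w z z' (graphOf_adj.2 h1) hz hz']
    have hnn := (hσ s(u, w)).1
    refine ⟨fun h => ⟨?_, ?_, fun hne => ⟨?_, ?_, ?_⟩⟩, fun h => ?_, fun h => ?_⟩
    · have : f u = w := h
      subst this
      exact hf.invol u
    · rintro rfl
      exact hl.unmatched _ h
    · have h' : f u = w := h
      have hadj := graphOf_adj.1 (hf.adj u (by rw [h']; exact hne))
      intro h0
      have := congrArg Fin.val h0
      simp only [D, Fin.val_zero] at this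
      omega
    · have h' : f u = w := h
      subst h'
      exact hl.barrier u hne
    · have h' : f u = w := h
      have hadj := graphOf_adj.1 (hf.adj u (by rw [h']; exact hne))
      rw [h'] at hadj
      exact hcross.resolve_left (not_not.2 hadj)
    · have h' : f u = w := h.1
      subst h'
      simp only [D]
      omega
    · have := hcross.resolve_right (not_not.2 h)
      omega
  have hres : ∀ i < P.len, (P.residualPoly (P.mults σ) c).eval (i : P.F) = 0 := by
    intro i hi
    rw [P.eval_residualPoly_node _ _ hi]
    have : P.residual (P.mults σ) c i = 0 := by
      by_cases hu : P.IsUse i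
      · rw [P.residual_eq_zero_iff hu]
        intro b
        have hlt := (P.other i b).2
        have hbuf := P.buffer_eq c i b (by
          have := Nat.div_add_mod i (2 * n)
          rw [IsUse] at hu
          omega)
        have hv' : P.vertex (2 * n * (i / (2 * n)) + P.other i b) = P.other i b := by
          apply Fin.ext
          rw [vertex, show 2 * n * (i / (2 * n)) + (P.other i b).val
            = (P.other i b).val + n * (2 * (i / (2 * n))) by ring]
          simp [Nat.mod_eq_of_lt hlt]
        rw [hbuf, hdec, hdec, hv']
        exact hpair _ _
      · exact P.residual_eq_zero_of_not_isUse hu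
    rw [this, Int.cast_zero]
  set Q := P.residualPoly (P.mults σ) c /ₘ P.nodal with hQ
  have hQmul : P.nodal * Q = P.residualPoly (P.mults σ) c := P.nodal_mul_divByMonic hres
  have hQdeg : Q.natDegree < 2 * P.len := by
    have h1 := P.natDegree_residualPoly_le (P.mults σ) c
    have h2 := natDegree_divByMonic (P.residualPoly (P.mults σ) c) P.nodal_monic
    rw [P.natDegree_nodal, ← hQ] at h2
    have := P.len_pos
    omega
  set v : ℕ → P.F × P.F × P.F := fun i => (c i, Q.coeff i, Q.coeff (P.len + i)) with hv
  refine ⟨((List.range P.len).map v).flatMap P.bitEncode, ?_, fun r => ?_⟩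
  · rw [List.length_flatMap]
    simp [Function.comp_def, P.length_bitEncode]
  · have hfold := foldl_readBit_flatMap P.L_pos P.bitDecode (P.step (P.symbolInc r)) P.bitEncode
      P.length_bitEncode P.bitDecode_bitEncode (0, 0, P.sketch r σ) ((List.range P.len).map v)
    rw [run, hfold, answer_foldl_step, if_pos]
    · rw [P.half_numMatched_eq (c := c)]
      convert hf using 2 with u
      simp only [hdec, hvert]
      rfl
    · rw [accepts_finalRegisters]
      refine ⟨by rw [hcons, eval_zero], ?_⟩
      rw [← P.eq_quotPoly hQdeg, hQmul]

/-- The scheme has perfect completeness, and its soundness error is at most `3 * len / p`. -/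
lemma isScheme_verifier {v : ℕ} (hv : P.verifier.SpaceAtMost v) :
    P.verifier.IsScheme (IsTurnstileStream P.B) maxMatching 0 (1 / 3) (P.len * P.L) v := by
  have hp : (0 : ℝ) < P.p := by exact_mod_cast P.prime.out.pos
  have hcoins : Nat.card P.verifier.Coins = P.p := Nat.card_zmod _
  refine ⟨hv, fun σ hσ => ?_, fun σ hσ help => ?_⟩
  · obtain ⟨help, hlen, hout⟩ := P.exists_help hσ
    refine ⟨help, hlen.le, ?_⟩
    have h : Nat.card {r : P.verifier.Coins //
        P.verifier.out r (P.verifier.summary r σ) help = some (maxMatching σ)} = P.p := by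
      rw [← hcoins]
      exact Nat.card_congr (Equiv.subtypeUnivEquiv fun r =>
        (P.out_verifier r σ help).trans (hout r))
    rw [Verifier.prob, h, hcoins, div_self hp.ne', sub_zero]
  · have h : Nat.card {r : P.verifier.Coins // P.verifier.out r (P.verifier.summary r σ) help ∉
        ({some (maxMatching σ), none} : Set (Option ℕ))} ≤ 3 * P.len := by
      refine le_trans (le_of_eq ?_) (P.card_wrong_le hσ help)
      refine Nat.card_congr (Equiv.subtypeEquivRight fun r => ?_)
      exact iff_of_eq (congrArg (fun o => ¬ o ∈ ({some (maxMatching σ), none} : Set (Option ℕ)))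
        (P.out_verifier r σ help))
    rw [Verifier.prob, hcoins, div_le_div_iff₀ hp (by norm_num)]
    have h2 : 9 * P.len ≤ P.p := P.len_le_p
    have h3 : Nat.card {r : P.verifier.Coins // P.verifier.out r (P.verifier.summary r σ) help ∉
        ({some (maxMatching σ), none} : Set (Option ℕ))} * 3 ≤ 1 * P.p := by omega
    exact_mod_cast h3

lemma card_memory_le {e : ℕ} (he : P.p ≤ 2 ^ e) :
    Nat.card P.Memory ≤ 2 ^ (e * (4 * P.s + 5) + 2 * P.L) := by
  have h1 : Nat.card P.Memory
      = (P.len + 2) * (P.p ^ P.s * P.p ^ (3 * P.s + 4))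
        * Nat.card {l : List Bool // l.length < P.L} := by
    simp [Nat.card_prod]
  have h2 : P.len + 2 ≤ P.p := by
    have := P.len_le_p
    have h := P.len_pos
    have : P.len = 2 * n * P.t := rfl
    have h3 : P.len ≠ 1 := by rw [this, mul_assoc]; omega
    omega
  have h3 : Nat.card {l : List Bool // l.length < P.L} ≤ 2 ^ (2 * P.L) := by
    refine (card_lists_length_lt_le _).trans ?_
    rw [two_mul, pow_add]
    exact Nat.mul_le_mul_right _ Nat.lt_two_pow_self.le
  rw [h1, pow_add 2]
  refine Nat.mul_le_mul ?_ h3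
  calc _ ≤ P.p * (P.p ^ P.s * P.p ^ (3 * P.s + 4)) := Nat.mul_le_mul_right _ h2
    _ = P.p ^ (4 * P.s + 5) := by rw [← pow_add, ← pow_succ']; congr 1; ring
    _ ≤ (2 ^ e) ^ (4 * P.s + 5) := Nat.pow_le_pow_left he _
    _ = _ := by rw [← pow_mul]

end SchemeParams

/-! ### Choice of the parameters -/

lemma exists_leftInverse_of_card_le {α β : Type*} [Finite α] [Finite β] [Nonempty α]
    (h : Nat.card α ≤ Nat.card β) : ∃ (f : α → β) (g : β → α), ∀ x, g (f x) = x := by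
  have := Fintype.ofFinite α
  have := Fintype.ofFinite β
  rw [Nat.card_eq_fintype_card, Nat.card_eq_fintype_card] at h
  obtain ⟨f⟩ := Function.Embedding.nonempty_of_card_le h
  exact ⟨f, Function.invFun f, Function.leftInverse_invFun f.injective⟩

/-- Every sufficiently large prime below `2 ^ e` gives a scheme. -/
lemma exists_schemeParams {n t s B p e : ℕ} (hn : 0 < n) (ht : 0 < t) (hst : n ≤ t * s)
    (he : 0 < e) (hp : p.Prime) (hpe : p ≤ 2 ^ e) (h1 : s * (B ^ 2 + 1) < p) (h2 : n < p)
    (h3 : 9 * (2 * n * t) ≤ p) (h4 : (n + 1) * (n * (B + 1)) ≤ p) :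
    ∃ P : SchemeParams n, P.t = t ∧ P.s = s ∧ P.B = B ∧ P.p = p ∧ P.L = 3 * e := by
  have : Fact p.Prime := ⟨hp⟩
  have : NeZero n := ⟨hn.ne'⟩
  obtain ⟨f, g, hfg⟩ := exists_leftInverse_of_card_le (α := Fin n) (β := Fin t × Fin s)
    (by simpa using hst)
  obtain ⟨enc, dec, hdec⟩ := exists_leftInverse_of_card_le (α := VertexData n B) (β := ZMod p)
    (by simpa [Nat.card_prod, Finite.card_option] using h4)
  obtain ⟨benc, bdec, hbdec⟩ := exists_leftInverse_of_card_le (α := ZMod p × ZMod p × ZMod p)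
    (β := Fin (3 * e) → Bool) (by
      rw [show Nat.card (ZMod p × ZMod p × ZMod p) = p * (p * p) by simp,
        show Nat.card (Fin (3 * e) → Bool) = 2 ^ (3 * e) by simp]
      calc p * (p * p) = p ^ 3 := by ring
        _ ≤ (2 ^ e) ^ 3 := Nat.pow_le_pow_left hpe 3
        _ = 2 ^ (3 * e) := by rw [← pow_mul, mul_comm])
  refine ⟨{ t := t, s := s, B := B, p := p, L := 3 * e, n_pos := hn, t_pos := ht
            L_pos := by omega
            prime := ⟨hp⟩, lt_p := h1, n_lt_p := h2, len_le_p := h3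
            chunk := fun a b => if h : a < t then g (⟨a, h⟩, b) else 0
            chunk_surj := fun w => ⟨(f w).1, (f w).1.2, (f w).2, by simp [hfg]⟩
            decode := dec, encode := enc, decode_encode := hdec
            bitDecode := fun l => bdec fun i => l.getD i false
            bitEncode := fun x => List.ofFn (benc x)
            length_bitEncode := fun x => by simp
            bitDecode_bitEncode := fun x => ?_ }, rfl, rfl, rfl, rfl, rfl⟩
  conv_rhs => rw [← hbdec x]
  congr 1
  ext i
  simp

lemma size_le_log {n : ℕ} (hn : 1 ≤ n) : (Nat.size n : ℝ) ≤ 3 * Real.log (n + 1) := by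
  have hz : 0 < Nat.size n := Nat.size_pos.2 hn
  have h1 : 2 ^ (Nat.size n - 1) ≤ n := Nat.lt_size.1 (by omega)
  have h2 : 2 ^ Nat.size n ≤ (n + 1) ^ 2 := by
    rw [← Nat.sub_add_cancel hz, pow_succ]
    nlinarith
  have h3 : (2 : ℝ) ^ Nat.size n ≤ ((n : ℝ) + 1) ^ 2 := by exact_mod_cast h2
  have h4 := Real.log_le_log (by positivity) h3
  rw [Real.log_pow, Real.log_pow] at h4
  have h5 := Real.log_two_gt_d9
  have h6 : (0 : ℝ) ≤ Nat.size n := by positivity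
  push_cast at h4
  nlinarith

/-- The scheme for chunks of size at most `n`; `e` is a multiple of `log n`. -/
lemma exists_scheme_of_le (d : ℕ) {n t s : ℕ} (hn : 1 ≤ n) (ht : 1 ≤ t) (hs : 1 ≤ s) (htn : t ≤ n)
    (hsn : s ≤ n) (hst : n ≤ t * s) {e : ℕ} (he : e = (2 * d + 8) * Nat.size n) :
    ∃ S : Verifier n, S.CoinsAtMost (15 * e * s) ∧
      S.IsScheme (IsTurnstileStream (n ^ d)) maxMatching 0 (1 / 3) (6 * (n * t) * e)
        (15 * e * s) := by
  have hz : 0 < Nat.size n := Nat.size_pos.2 hn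
  obtain ⟨M, hM⟩ : ∃ M, M = 2 ^ Nat.size n := ⟨_, rfl⟩
  have hnM : n < M := hM ▸ Nat.lt_size_self n
  have hM2 : 2 ≤ M := by omega
  have he0 : 0 < e := by rw [he]; positivity
  obtain ⟨p, hp, hlt, hle⟩ := Nat.exists_prime_lt_and_le_two_mul (2 ^ (e - 1)) (by positivity)
  have hpe : p ≤ 2 ^ e := by
    rwa [← pow_succ', Nat.sub_add_cancel he0] at hle
  have hK : M ^ (2 * d + 7) < p := by
    refine lt_of_le_of_lt ?_ hlt
    rw [hM, ← pow_mul]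
    refine Nat.pow_le_pow_right (by norm_num) ?_
    rw [he, show 2 * d + 8 = (2 * d + 7) + 1 by ring, add_mul, mul_comm (Nat.size n)]
    omega
  have hmono : ∀ {a b : ℕ}, a ≤ b → M ^ a ≤ M ^ b := fun h => Nat.pow_le_pow_right (by omega) h
  have hB : n ^ d ≤ M ^ d := Nat.pow_le_pow_left hnM.le d
  have hone : ∀ k, 1 ≤ M ^ k := fun k => Nat.one_le_pow _ _ (by omega)
  have hsucc : ∀ k, M ^ k + 1 ≤ M ^ (k + 1) := fun k => by
    have := hone k
    rw [pow_succ]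
    nlinarith
  have h1 : s * ((n ^ d) ^ 2 + 1) < p := by
    refine lt_of_le_of_lt ?_ hK
    calc s * ((n ^ d) ^ 2 + 1) ≤ M * ((M ^ d) ^ 2 + 1) := by gcongr; omega
      _ ≤ M * M ^ (2 * d + 1) := by
          rw [← pow_mul, mul_comm d]
          exact Nat.mul_le_mul_left _ (hsucc _)
      _ = M ^ (2 * d + 2) := by ring
      _ ≤ _ := hmono (by omega)
  have h2 : n < p := by
    have : M ^ 1 ≤ M ^ (2 * d + 7) := hmono (by omega)
    rw [pow_one] at this
    omega
  have h3 : 9 * (2 * n * t) ≤ p := by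
    refine le_trans ?_ hK.le
    calc 9 * (2 * n * t) = 18 * (n * t) := by ring
      _ ≤ M ^ 5 * (M * M) := by
          have h : 2 ^ 5 ≤ M ^ 5 := Nat.pow_le_pow_left hM2 5
          exact Nat.mul_le_mul (by omega) (Nat.mul_le_mul (by omega) (by omega))
      _ = M ^ 7 := by ring
      _ ≤ _ := hmono (by omega)
  have h4 : (n + 1) * (n * (n ^ d + 1)) ≤ p := by
    refine le_trans ?_ hK.le
    calc (n + 1) * (n * (n ^ d + 1)) ≤ M * (M * M ^ (d + 1)) :=
          Nat.mul_le_mul (by omega) (Nat.mul_le_mul hnM.le ((Nat.succ_le_succ hB).trans (hsucc d)))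
      _ = M ^ (d + 3) := by ring
      _ ≤ _ := hmono (by omega)
  obtain ⟨P, rfl, rfl, hPB, rfl, hPL⟩ := exists_schemeParams hn ht hst he0 hp hpe h1 h2 h3 h4
  have hes : e ≤ e * P.s := Nat.le_mul_of_pos_right _ hs
  refine ⟨P.verifier, ?_, ?_⟩
  · refine (Nat.card_zmod P.p).le.trans (hpe.trans (Nat.pow_le_pow_right (by norm_num) ?_))
    rw [mul_assoc]
    omega
  · have h := P.isScheme_verifier (v := 15 * e * P.s)
      ((P.card_memory_le hpe).trans (Nat.pow_le_pow_right (by norm_num) ?_))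
    · rw [hPB] at h
      convert h using 1
      rw [hPL, SchemeParams.len]
      ring
    · rw [hPL]
      nlinarith

/-- The upper bound: a scheme with help `Õ(n t)` and space `Õ(s)`. Values of `t` and `s` above `n` are
of no use and replaced by `n`. -/
theorem exists_scheme (d : ℕ) {n t s : ℕ} (hn : 1 ≤ n) (ht : 1 ≤ t) (hs : 1 ≤ s)
    (hst : n ≤ t * s) : ∃ (h v : ℕ) (S : Verifier n),
      (h : ℝ) ≤ 45 * (2 * d + 8) * ((n : ℝ) * t) * Real.log (n + 1) ∧
      (v : ℝ) ≤ 45 * (2 * d + 8) * (s : ℝ) * Real.log (n + 1) ∧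
      S.CoinsAtMost v ∧ S.IsScheme (IsTurnstileStream (n ^ d)) maxMatching 0 (1 / 3) h v := by
  have hst' : n ≤ min t n * min s n := by
    rcases le_total t n with h1 | h1 <;> rcases le_total s n with h2 | h2 <;>
      simp only [h1, h2, min_eq_left, min_eq_right] <;> nlinarith
  obtain ⟨S, hS1, hS2⟩ := exists_scheme_of_le d hn (le_min ht hn) (le_min hs hn)
    (min_le_right t n) (min_le_right s n) hst' rfl
  refine ⟨_, _, S, ?_, ?_, hS1, hS2⟩
  · have hz := size_le_log hn
    have ht' : ((min t n : ℕ) : ℝ) ≤ t := by exact_mod_cast min_le_left t n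
    have hlog : 0 ≤ Real.log ((n : ℝ) + 1) := Real.log_nonneg (by linarith [n.cast_nonneg (α := ℝ)])
    push_cast at ht' ⊢
    calc 6 * ((n : ℝ) * min (t : ℝ) n) * ((2 * d + 8) * Nat.size n)
        ≤ 6 * ((n : ℝ) * t) * ((2 * d + 8) * (3 * Real.log (n + 1))) := by gcongr
      _ = 18 * ((2 * d + 8) * ((n : ℝ) * t) * Real.log (n + 1)) := by ring
      _ ≤ 45 * ((2 * d + 8) * ((n : ℝ) * t) * Real.log (n + 1)) := by gcongr; norm_num
      _ = _ := by ring
  · have hz := size_le_log hn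
    have hs' : ((min s n : ℕ) : ℝ) ≤ s := by exact_mod_cast min_le_left s n
    have hlog : 0 ≤ Real.log ((n : ℝ) + 1) := Real.log_nonneg (by linarith [n.cast_nonneg (α := ℝ)])
    push_cast at hs' ⊢
    calc 15 * ((2 * d + 8) * (Nat.size n : ℝ)) * min (s : ℝ) n
        ≤ 15 * ((2 * d + 8) * (3 * Real.log (n + 1))) * s := by gcongr
      _ = _ := by ring

end GraphStream

theorem mainTheorem4 :
    -- the schemes: help `Õ(n t)`, space (including the random coins) `Õ(s)`
    (∀ d : ℕ, ∃ (C : ℝ) (k : ℕ), ∀ n t s : ℕ, 1 ≤ n → 1 ≤ t → 1 ≤ s → n ≤ t * s →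
      ∃ (h v : ℕ) (S : GraphStream.Verifier n),
        (h : ℝ) ≤ C * ((n : ℝ) * t) * Real.log (n + 1) ^ k ∧
        (v : ℝ) ≤ C * (s : ℝ) * Real.log (n + 1) ^ k ∧
        S.CoinsAtMost v ∧
        S.IsScheme (GraphStream.IsTurnstileStream (n ^ d)) GraphStream.maxMatching
          0 (1 / 3) h v) ∧
    -- the matching lower bound `h v = Ω(n ^ 2)`
    (∃ c : ℝ, 0 < c ∧ ∀ n h v : ℕ, 2 ≤ n → 1 ≤ h → ∀ S : GraphStream.Verifier n,
      S.IsScheme GraphStream.IsInsertionStream GraphStream.maxMatching (1 / 3) (1 / 3) h v →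
      c * (n : ℝ) ^ 2 ≤ (h : ℝ) * v) := by
  refine ⟨fun d => ⟨45 * (2 * d + 8), 1, fun n t s hn ht hs hst => ?_⟩,
    ⟨1 / 24576, by norm_num, fun n h v hn hh S hS => GraphStream.lower_bound hn hh S hS⟩⟩
  simpa only [pow_one] using GraphStream.exists_scheme d hn ht hs hst
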